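/- Let $n\ge 1$, $x^o\in\mathbb R^n$ (the object), $a_1,a_2,\dots\in\mathbb R^n$ (the sensors), and let $d_i=\|a_i-x^o\|+r_i$ be range measurements, where the noises $r_i$ are i.i.d. $\mathcal N(0,\sigma^2)$, $\sigma^2<\infty$. Assume that (i) $x^o$ is an interior point of a compact set $\mathcal X\subset\mathbb R^n$, the $a_i$ lie in a bounded set $\mathcal A$, and $a_i\notin\mathcal X$ for every $i$; (ii) the sample distribution functions $F_m(z)=\frac1m\#\{i\le m: a_i\preceq z\}$ (coordinatewise order) converge to the distribution function $F_\mu$ of a probability measure $\mu$ on $\mathbb R^n$ at every continuity point of $F_\mu$. For real sequences $p,q$ let $\langle p,q\rangle_t=\lim_{t\to\infty}t^{-1}\sum_{i=1}^t p_iq_i$ (tail product, when the limit exists) and $\|p\|_t^2=\langle p,p\rangle_t$. Put $f_i(x)=\|a_i-x\|$, $f(x)=(f_i(x))_i$, and $f_j'(x)=(\partial f_i(x)/\partial x_j)_i$. Let the search region $\Theta$ be either $\mathbb R^n$ or $\mathcal X$, and let $\hat x^{\rm LS}_m$ be a (measurable) least-squares estimator, i.e. a minimizer over $x\in\Theta$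 of $\sum_{i=1}^m(\|a_i-x\|-d_i)^2$. Assume moreover that either (iii) $\|f(x)-f(x^o)\|_t^2$, $x\in\Theta$, has its unique minimum at $x=x^o$ (asymptotic unique localizability), and no affine hyperplane $\mathcal S$ (a line if $n=2$, a plane if $n=3$) satisfies both $x^o\in\mathcal S$ and $\mu(\mathcal S)=1$; or (iii$'$) no affine hyperplane $\mathcal S$ satisfies $\mu(\mathcal S)=1$. Then $\hat x^{\rm LS}_m\to x^o$ with probability one as $m\to\infty$. Moreover, the tail products $M_{jk}(x^o)=\langle f_j'(x^o),f_k'(x^o)\rangle_t$ exist, the matrix $M(x^o)$ is positive definite, and $$\sqrt m\,(\hat x^{\rm LS}_m-x^o)\to\mathcal N\bigl(0,\sigma^2M(x^o)^{-1}\bigr)\quad\text{in distribution as } m\to\infty .$$ -/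

import Mathlib

open MeasureTheory ProbabilityTheory Filter Topology
open scoped NNReal Matrix

noncomputable section

/-- The averages `t⁻¹ ∑_{i < t} p i * q i` converge to the real number `L`: the tail product of the
sequences `p` and `q` exists and equals `L`. -/
def HasTailProduct (p q : ℕ → ℝ) (L : ℝ) : Prop :=
  Tendsto (fun t : ℕ => (t : ℝ)⁻¹ * ∑ i ∈ Finset.range t, p i * q i) atTop (𝓝 L)

/-- The tail product `⟨p, q⟩_t` (a meaningful number only when the averages converge). -/
def tailProduct (p q : ℕ → ℝ) : ℝ :=
  limUnder atTop (fun t : ℕ => (t : ℝ)⁻¹ * ∑ i ∈ Finset.range t, p i * q i)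

theorem HasTailProduct.tailProduct_eq {p q : ℕ → ℝ} {L : ℝ} (h : HasTailProduct p q L) :
    tailProduct p q = L :=
  h.limUnder_eq

/-- The tail norm `‖p‖_t = √⟨p, p⟩_t`. -/
def tailNorm (p : ℕ → ℝ) : ℝ := √(tailProduct p p)

variable {n : ℕ}

/-- The sequence `f(x) = (f_i(x))`, `f_i(x) = ‖a_i - x‖`, of distances from `x` to the sensors. -/
def rangeSeq (a : ℕ → EuclideanSpace ℝ (Fin n)) (x : EuclideanSpace ℝ (Fin n)) : ℕ → ℝ :=
  fun i => ‖a i - x‖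

/-- The sequence `f_j'(x) = (∂ f_i(x) / ∂ x_j)` of partial derivatives of the distances. -/
def rangePartial (a : ℕ → EuclideanSpace ℝ (Fin n)) (j : Fin n) (x : EuclideanSpace ℝ (Fin n)) :
    ℕ → ℝ :=
  fun i => fderiv ℝ (fun y => rangeSeq a y i) x (EuclideanSpace.single j 1)

/-- The matrix `M(x)` with entries `M_{jk}(x) = ⟨f_j'(x), f_k'(x)⟩_t`. -/
def tailGram (a : ℕ → EuclideanSpace ℝ (Fin n)) (x : EuclideanSpace ℝ (Fin n)) :
    Matrix (Fin n) (Fin n) ℝ :=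
  Matrix.of fun j k => tailProduct (rangePartial a j x) (rangePartial a k x)

/-- Least squares objective `∑_{i < m} (‖a_i - x‖ - d_i)²` of the first `m` measurements. -/
def lsObjective (a : ℕ → EuclideanSpace ℝ (Fin n)) (d : ℕ → ℝ) (m : ℕ)
    (x : EuclideanSpace ℝ (Fin n)) : ℝ :=
  ∑ i ∈ Finset.range m, (‖a i - x‖ - d i) ^ 2

/-- `x` is an optimal solution of the least squares problem over the search region `Θ`. -/
def IsLSEstimate (Θ : Set (EuclideanSpace ℝ (Fin n))) (a : ℕ → EuclideanSpace ℝ (Fin n))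
    (d : ℕ → ℝ) (m : ℕ) (x : EuclideanSpace ℝ (Fin n)) : Prop :=
  x ∈ Θ ∧ IsMinOn (lsObjective a d m) Θ x

open Classical in
/-- Sample distribution function `F_m(z)`: the proportion of the first `m` vectors of the sequence
that are coordinatewise at most `z`. -/
def sampleCDF (a : ℕ → EuclideanSpace ℝ (Fin n)) (m : ℕ) (z : EuclideanSpace ℝ (Fin n)) : ℝ :=
  (((Finset.range m).filter fun i => ∀ j, a i j ≤ z j).card : ℝ) / m

/-- Joint distribution function of a measure on `ℝⁿ`. -/
def jointCDF (μ : Measure (EuclideanSpace ℝ (Fin n))) (z : EuclideanSpace ℝ (Fin n)) : ℝ :=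
  μ.real {y | ∀ j, y j ≤ z j}

/-- The sample distribution functions converge to the distribution function of `μ` at every point
where the latter is continuous. -/
def SampleCDFTendsto (a : ℕ → EuclideanSpace ℝ (Fin n))
    (μ : Measure (EuclideanSpace ℝ (Fin n))) : Prop :=
  ∀ z, ContinuousAt (jointCDF μ) z → Tendsto (fun m => sampleCDF a m z) atTop (𝓝 (jointCDF μ z))

/-- Asymptotic unique localizability: over the search region `Θ`, the squared tail norm
`‖f(x) - f(xo)‖_t²` has its unique minimum at `x = xo`. -/
def AsymptoticallyUniquelyLocalizable (Θ : Set (EuclideanSpace ℝ (Fin n)))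
    (a : ℕ → EuclideanSpace ℝ (Fin n)) (xo : EuclideanSpace ℝ (Fin n)) : Prop :=
  ∀ x ∈ Θ, x ≠ xo →
    tailNorm (rangeSeq a xo - rangeSeq a xo) ^ 2 < tailNorm (rangeSeq a x - rangeSeq a xo) ^ 2

/-- An affine hyperplane of `ℝⁿ`: a line when `n = 2`, a plane when `n = 3`. -/
def IsAffineHyperplane (S : AffineSubspace ℝ (EuclideanSpace ℝ (Fin n))) : Prop :=
  (S : Set (EuclideanSpace ℝ (Fin n))).Nonempty ∧ Module.finrank ℝ S.direction + 1 = n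

end

/-! The argument separates the deterministic geometry of the sensors from finitely or countably many
laws of large numbers for the noise, and then works with one noise realization at a time.

Convergence of the sample distribution functions is weak convergence of the empirical measures, so
averages of bounded continuous functions of the sensors converge to `μ`-integrals
(`SampleCDFTendsto.tendsto_average`). This yields both the limiting discrepancy `meanSqDiscrepancy`
and the limiting Gram matrix `gramLimit`. If the discrepancy vanished at `x ≠ xo`, then `μ` would
live on the perpendicular bisector of `x` and `xo`; if the Gram form vanished in a direction, `μ`
would live on the hyperplane through `xo` orthogonal to it.

Consistency (`tendsto_of_isLSEstimate`) compares the objective at the estimate and at `xo`. The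
estimates stay bounded, and at any cluster point the discrepancy is dominated by noise averages
tending to zero. Distances are 1-Lipschitz in `x` uniformly in the sensor, so a law of large numbers
on a countable dense set suffices.

For normality, the first-order condition is expanded around `xo`. The noise-weighted Hessian
averages out, leaving `M h = z + o(h)`, with `h` the error and `z` the average of gradient times
noise (`isLittleO_normal_equation`). Inverting gives `h = M⁻¹ z + o(M⁻¹ z)`. The rescaled main term
is exactly Gaussian for each `m`, and its characteristic function converges; a Slutsky argument
(`MeasureTheory.TendstoInDistribution.of_ae_isLittleO`) absorbs the remainder. -/

open scoped InnerProductSpace Asymptotics ENNReal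

/-! ### Weak convergence of the empirical sensor measures. -/

noncomputable section

variable {n : ℕ}

/-- The set of points that are coordinatewise at most `z`. -/
def lowerOrthant (z : EuclideanSpace ℝ (Fin n)) : Set (EuclideanSpace ℝ (Fin n)) :=
  {y | ∀ j, y j ≤ z j}

/-- The values `t` such that `μ` does not charge the hyperplane `y j = t`. -/
def uncharged (μ : Measure (EuclideanSpace ℝ (Fin n))) (j : Fin n) : Set ℝ :=
  {t | μ {y | y j = t} = 0}

/-- Parallel hyperplanes are disjoint, so only countably many carry mass. Box corners with uncharged
coordinates can hence be found as close to a given point as needed. -/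
theorem dense_uncharged (μ : Measure (EuclideanSpace ℝ (Fin n))) [SFinite μ] (j : Fin n) :
    Dense (uncharged μ j) := by
  have h : {t : ℝ | 0 < μ {y : EuclideanSpace ℝ (Fin n) | y j = t}}.Countable :=
    Measure.countable_meas_level_set_pos (by fun_prop)
  convert h.dense_compl ℝ using 1
  ext t
  simp [uncharged]

theorem measurableSet_lowerOrthant (z : EuclideanSpace ℝ (Fin n)) :
    MeasurableSet (lowerOrthant z) := by
  have : lowerOrthant z = ⋂ j, {y : EuclideanSpace ℝ (Fin n) | y j ≤ z j} := by
    ext y; simp [lowerOrthant]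
  rw [this]
  exact MeasurableSet.iInter fun j => measurableSet_le (by fun_prop) measurable_const

theorem lowerOrthant_inter (z w : EuclideanSpace ℝ (Fin n)) :
    lowerOrthant z ∩ lowerOrthant w = lowerOrthant (WithLp.toLp 2 fun j => min (z j) (w j)) := by
  ext y
  simp [lowerOrthant, forall_and]

/-- The joint distribution function is continuous at points with uncharged coordinates. -/
theorem continuousAt_jointCDF (μ : Measure (EuclideanSpace ℝ (Fin n))) [IsProbabilityMeasure μ]
    {z : EuclideanSpace ℝ (Fin n)} (hz : ∀ j, z j ∈ uncharged μ j) :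
    ContinuousAt (jointCDF μ) z := by
  have h : jointCDF μ = fun w => ∫ y, (lowerOrthant w).indicator (fun _ => (1 : ℝ)) y ∂μ := by
    funext w
    rw [integral_indicator_const _ (measurableSet_lowerOrthant w)]
    simp [jointCDF, lowerOrthant]
  rw [h]
  refine continuousAt_of_dominated (bound := fun _ => 1) ?_ ?_ (integrable_const _) ?_
  · exact .of_forall fun w => (measurable_const.indicator
      (measurableSet_lowerOrthant w)).aestronglyMeasurable
  · refine .of_forall fun w => .of_forall fun y => ?_
    by_cases hy : y ∈ lowerOrthant w <;> simp [hy]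
  · have hne : ∀ᵐ y ∂μ, ∀ j, y j ≠ z j := by
      rw [ae_all_iff]
      intro j
      rw [ae_iff]
      simp only [ne_eq, not_not]
      exact hz j
    filter_upwards [hne] with y hy
    have hev : ∀ᶠ w in 𝓝 z, ∀ j, (y j ≤ w j ↔ y j ≤ z j) := by
      rw [eventually_all]
      intro j
      have hc : ContinuousAt (fun w : EuclideanSpace ℝ (Fin n) => w j) z := by fun_prop
      rcases lt_or_gt_of_ne (hy j) with hlt | hlt
      · filter_upwards [hc.eventually_const_lt hlt] with w hw
        exact ⟨fun _ => hlt.le, fun _ => hw.le⟩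
      · filter_upwards [hc.eventually_lt_const hlt] with w hw
        exact ⟨fun h' => absurd h' (not_le.2 hw), fun h' => absurd h' (not_le.2 hlt)⟩
    refine ContinuousAt.congr (f := fun _ => (lowerOrthant z).indicator (fun _ => (1 : ℝ)) y)
      continuousAt_const ?_
    filter_upwards [hev] with w hw
    have : y ∈ lowerOrthant w ↔ y ∈ lowerOrthant z := forall_congr' hw
    by_cases hyz : y ∈ lowerOrthant z
    · simp [hyz, this.2 hyz]
    · simp [hyz, this]

/-- Convergence of distribution functions at all points with uncharged coordinates implies weak
convergence. -/
theorem tendsto_probabilityMeasure_of_tendsto_jointCDF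
    {ν : ℕ → ProbabilityMeasure (EuclideanSpace ℝ (Fin n))}
    {μ : ProbabilityMeasure (EuclideanSpace ℝ (Fin n))}
    (h : ∀ z : EuclideanSpace ℝ (Fin n),
      (∀ j, z j ∈ uncharged (μ : Measure (EuclideanSpace ℝ (Fin n))) j) →
      Tendsto (fun m => jointCDF (ν m : Measure (EuclideanSpace ℝ (Fin n))) z) atTop
        (𝓝 (jointCDF (μ : Measure (EuclideanSpace ℝ (Fin n))) z))) :
    Tendsto ν atTop (𝓝 μ) := by
  classical
  let E := EuclideanSpace ℝ (Fin n)
  set G : Fin n → Set ℝ := fun j => uncharged (μ : Measure E) j with hG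
  let O : Set (Set E) := {s | ∃ z : E, (∀ j, z j ∈ G j) ∧ s = lowerOrthant z}
  have hmin : ∀ j s t, s ∈ G j → t ∈ G j → min s t ∈ G j := by
    intro j s t hs ht
    rcases min_choice s t with h' | h' <;> rwa [h']
  have hmax : ∀ j s t, s ∈ G j → t ∈ G j → max s t ∈ G j := by
    intro j s t hs ht
    rcases max_choice s t with h' | h' <;> rwa [h']
  have hO : IsPiSystem O := by
    rintro _ ⟨z, hz, rfl⟩ _ ⟨w, hw, rfl⟩ _
    exact ⟨_, fun j => hmin j _ _ (hz j) (hw j), lowerOrthant_inter z w⟩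
  have hOm : ∀ s ∈ O, MeasurableSet s := by
    rintro _ ⟨z, -, rfl⟩
    exact measurableSet_lowerOrthant z
  have hOt : ∀ s ∈ O, Tendsto (fun m => (ν m : Measure E).real s) atTop
      (𝓝 ((μ : Measure E).real s)) := by
    rintro _ ⟨z, hz, rfl⟩
    exact h z hz
  -- Half-open boxes with uncharged corners form a π-system that is fine enough to determine weak
  -- convergence, and their measures are computable from orthants.
  let box : E → E → Set E := fun p q => {y | ∀ j, p j < y j ∧ y j ≤ q j}
  let S : Set (Set E) := {s | ∃ p q : E, (∀ j, p j ∈ G j) ∧ (∀ j, q j ∈ G j) ∧ s = box p q}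
  -- Removing from the orthant of `q` the orthants with one coordinate lowered to `p` leaves the
  -- box. The `min` keeps the removed sets inside the orthant even when `p ≤ q` fails, so measures
  -- subtract.
  let corner : E → E → Fin n → E := fun p q i =>
    WithLp.toLp 2 fun j => if j = i then min (p j) (q j) else q j
  let T : E → E → Finset (Set E) := fun p q =>
    Finset.univ.image fun i => lowerOrthant (corner p q i)
  have hbox : ∀ p q, box p q = lowerOrthant q \ ⋃ s ∈ T p q, s := by
    intro p q
    ext y
    simp only [box, T, corner, lowerOrthant, Set.mem_ofPred_eq, Set.mem_sdiff, Finset.mem_image,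
      Finset.mem_univ, true_and, Set.iUnion_exists, Set.iUnion_iUnion_eq', Set.mem_iUnion,
      not_exists]
    constructor
    · intro hy
      refine ⟨fun j => (hy j).2, fun i hi => ?_⟩
      have := hi i
      simp only [if_true, le_min_iff] at this
      exact absurd this.1 (not_le.2 (hy i).1)
    · rintro ⟨hy, hy'⟩ j
      refine ⟨?_, hy j⟩
      by_contra hlt
      refine hy' j fun k => ?_
      by_cases hk : k = j
      · subst hk
        simpa using ⟨not_lt.1 hlt, hy k⟩
      · simpa [hk] using hy k
  have hTsub : ∀ p q, (⋃ s ∈ T p q, s) ⊆ lowerOrthant q := by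
    intro p q y hy
    simp only [T, corner, lowerOrthant, Finset.mem_image,
      Finset.mem_univ, true_and, Set.iUnion_exists, Set.iUnion_iUnion_eq', Set.mem_iUnion] at hy
    obtain ⟨i, hi⟩ := hy
    intro j
    have := hi j
    split_ifs at this
    · exact this.trans (min_le_right _ _)
    · exact this
  have hTO : ∀ p q : E, (∀ j, p j ∈ G j) → (∀ j, q j ∈ G j) → ∀ s ∈ T p q, s ∈ O := by
    intro p q hp hq s hs
    simp only [T, Finset.mem_image, Finset.mem_univ, true_and] at hs
    obtain ⟨i, rfl⟩ := hs
    refine ⟨_, fun j => ?_, rfl⟩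
    simp only [corner]
    split_ifs
    · exact hmin j _ _ (hp j) (hq j)
    · exact hq j
  have hTm : ∀ p q, MeasurableSet (⋃ s ∈ T p q, s) := by
    intro p q
    refine Finset.measurableSet_biUnion _ fun s hs => ?_
    simp only [T, Finset.mem_image, Finset.mem_univ, true_and] at hs
    obtain ⟨i, rfl⟩ := hs
    exact measurableSet_lowerOrthant _
  refine IsPiSystem.tendsto_probabilityMeasure_of_tendsto_of_mem (S := S) ?_ ?_ ?_ ?_
  · rintro _ ⟨p, q, hp, hq, rfl⟩ _ ⟨p', q', hp', hq', rfl⟩ _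
    refine ⟨WithLp.toLp 2 fun j => max (p j) (p' j), WithLp.toLp 2 fun j => min (q j) (q' j),
      fun j => hmax j _ _ (hp j) (hp' j), fun j => hmin j _ _ (hq j) (hq' j), ?_⟩
    ext y
    simp only [box, Set.mem_inter_iff, Set.mem_ofPred_eq, max_lt_iff, le_min_iff, ← forall_and]
    exact forall_congr' fun j => by tauto
  · rintro _ ⟨p, q, -, -, rfl⟩
    rw [hbox]
    exact (measurableSet_lowerOrthant q).diff (hTm p q)
  · intro u hu x hx
    let e := (PiLp.homeomorph 2 (fun _ : Fin n => ℝ))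
    have hu' : IsOpen (e.symm ⁻¹' u) := hu.preimage e.symm.continuous
    obtain ⟨ε, hε, hball⟩ := Metric.isOpen_iff.1 hu' (e x) (by simpa using hx)
    have hp : ∀ j, ∃ t ∈ G j, t ∈ Set.Ioo (x j - ε) (x j) := fun j =>
      (dense_uncharged (μ : Measure E) j).exists_between (by linarith)
    have hq : ∀ j, ∃ t ∈ G j, t ∈ Set.Ioo (x j) (x j + ε) := fun j =>
      (dense_uncharged (μ : Measure E) j).exists_between (by linarith)
    choose p hpG hp using hp
    choose q hqG hq using hq
    refine ⟨box (WithLp.toLp 2 p) (WithLp.toLp 2 q), ⟨_, _, hpG, hqG, rfl⟩, ?_, ?_⟩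
    · have : ∀ᶠ y : E in 𝓝 x, ∀ j, p j < y j ∧ y j ≤ q j := by
        rw [eventually_all]
        intro j
        have hc : ContinuousAt (fun w : EuclideanSpace ℝ (Fin n) => w j) x := by fun_prop
        filter_upwards [hc.eventually_const_lt (hp j).2, hc.eventually_lt_const (hq j).1]
          with w h1 h2
        exact ⟨h1, h2.le⟩
      exact this
    · intro y hy
      have : e y ∈ Metric.ball (e x) ε := by
        rw [Metric.mem_ball, dist_pi_lt_iff hε]
        intro j
        have h1 := hy j
        have h2 := hp j
        have h3 := hq j
        simp only [Set.mem_Ioo] at h2 h3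
        change dist (y j) (x j) < ε
        rw [Real.dist_eq, abs_lt]
        change p j < y j ∧ y j ≤ q j at h1
        constructor <;> linarith
      simpa using hball this
  · rintro _ ⟨p, q, hp, hq, rfl⟩
    have h1 := hO.tendsto_measureReal_biUnion (hTO p q hp hq) hOm hOt
    have h2 := (h q hq).sub h1
    have key : ∀ κ : ProbabilityMeasure E, ((κ (box p q) : ℝ≥0) : ℝ)
        = jointCDF (κ : Measure E) q - (κ : Measure E).real (⋃ s ∈ T p q, s) := by
      intro κ
      have := measureReal_sdiff (μ := (κ : Measure E)) (hTsub p q) (hTm p q)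
      rw [hbox]
      exact this
    rw [← NNReal.tendsto_coe]
    simp_rw [key]
    exact h2

/-- The empirical measure of the first `m + 1` terms of the sequence `a`. -/
def empiricalMeasure (a : ℕ → EuclideanSpace ℝ (Fin n)) (m : ℕ) :
    Measure (EuclideanSpace ℝ (Fin n)) :=
  ((m + 1 : ℕ) : ℝ≥0∞)⁻¹ • ∑ i ∈ Finset.range (m + 1), Measure.dirac (a i)

instance (a : ℕ → EuclideanSpace ℝ (Fin n)) (m : ℕ) :
    IsProbabilityMeasure (empiricalMeasure a m) := by
  constructor
  simp only [empiricalMeasure, Measure.smul_apply, Measure.finsetSum_apply, measure_univ,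
    Finset.sum_const, Finset.card_range, smul_eq_mul, nsmul_eq_mul, mul_one]
  exact ENNReal.inv_mul_cancel (by simp) (by simp)

theorem integral_empiricalMeasure (a : ℕ → EuclideanSpace ℝ (Fin n)) (m : ℕ)
    {φ : EuclideanSpace ℝ (Fin n) → ℝ} :
    ∫ y, φ y ∂(empiricalMeasure a m)
      = ((m + 1 : ℕ) : ℝ)⁻¹ * ∑ i ∈ Finset.range (m + 1), φ (a i) := by
  rw [empiricalMeasure, integral_smul_measure, integral_finsetSum_measure
    (fun i _ => integrable_dirac (by simp)),
    ENNReal.toReal_inv, ENNReal.toReal_natCast]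
  simp

theorem jointCDF_empiricalMeasure (a : ℕ → EuclideanSpace ℝ (Fin n)) (m : ℕ)
    (z : EuclideanSpace ℝ (Fin n)) :
    jointCDF (empiricalMeasure a m) z = sampleCDF a (m + 1) z := by
  have h := integral_indicator_const (μ := empiricalMeasure a m) (1 : ℝ)
    (measurableSet_lowerOrthant z)
  rw [integral_empiricalMeasure] at h
  simp only [smul_eq_mul, mul_one] at h
  change (empiricalMeasure a m).real (lowerOrthant z) = _
  rw [← h, sampleCDF, div_eq_inv_mul]
  congr 1
  rw [Finset.card_filter]
  push_cast
  refine Finset.sum_congr rfl fun i _ => ?_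
  simp only [Set.indicator, lowerOrthant, Set.mem_ofPred_eq]
  split_ifs with hi <;> simp [hi]

/-- If the sample distribution functions converge, averages of bounded continuous functions
converge to the integral with respect to the limit measure. -/
theorem SampleCDFTendsto.tendsto_average {a : ℕ → EuclideanSpace ℝ (Fin n)}
    {μ : Measure (EuclideanSpace ℝ (Fin n))} [IsProbabilityMeasure μ]
    (h : SampleCDFTendsto a μ) {φ : EuclideanSpace ℝ (Fin n) → ℝ} (hφ : Continuous φ)
    {C : ℝ} (hC : ∀ y, |φ y| ≤ C) :
    Tendsto (fun t : ℕ => (t : ℝ)⁻¹ * ∑ i ∈ Finset.range t, φ (a i)) atTop (𝓝 (∫ y, φ y ∂μ)) := by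
  -- The shift drops the empty average, for which there is no empirical probability measure.
  rw [← tendsto_add_atTop_iff_nat 1]
  let ν : ℕ → ProbabilityMeasure (EuclideanSpace ℝ (Fin n)) := fun m =>
    ⟨empiricalMeasure a m, inferInstance⟩
  let ν₀ : ProbabilityMeasure (EuclideanSpace ℝ (Fin n)) := ⟨μ, inferInstance⟩
  have hν : Tendsto ν atTop (𝓝 ν₀) := by
    refine tendsto_probabilityMeasure_of_tendsto_jointCDF fun z hz => ?_
    have := (tendsto_add_atTop_iff_nat 1).2 (h z (continuousAt_jointCDF μ hz))
    refine this.congr fun m => ?_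
    exact (jointCDF_empiricalMeasure a m z).symm
  have hν' := ProbabilityMeasure.tendsto_iff_forall_integral_tendsto.1 hν
  refine (hν' (BoundedContinuousFunction.ofNormedAddCommGroup φ hφ C hC)).congr fun m => ?_
  exact integral_empiricalMeasure a m

end

/-! ### Laws of large numbers for the noise. -/

noncomputable section

/-- Almost sure upper bound on averages of independent sub-Gaussian variables. -/
theorem ae_eventually_average_lt {Ω : Type*} [MeasurableSpace Ω] {P : Measure Ω}
    [IsProbabilityMeasure P] {X : ℕ → Ω → ℝ} (hX : iIndepFun X P) {c : ℝ≥0} (hc : 0 < c)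
    (hsub : ∀ i, HasSubgaussianMGF (X i) c P) {ε : ℝ} (hε : 0 < ε) :
    ∀ᵐ ω ∂P, ∀ᶠ m : ℕ in atTop, (m : ℝ)⁻¹ * ∑ i ∈ Finset.range m, X i ω < ε := by
  let s : ℕ → Set Ω := fun m => {ω | m * ε ≤ ∑ i ∈ Finset.range m, X i ω}
  set q : ℝ := Real.exp (-ε ^ 2 / (2 * c)) with hq
  have hc' : (0 : ℝ) < c := hc
  have hq1 : q < 1 := by
    rw [hq, Real.exp_lt_one_iff]
    exact div_neg_of_neg_of_pos (by nlinarith) (by positivity)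
  -- The Chernoff bound for a sum of `m` terms at level `m * ε` is geometric in `m`, so
  -- Borel–Cantelli applies.
  have hbound : ∀ m, P (s m) ≤ ENNReal.ofReal (q ^ m) := by
    intro m
    have h := HasSubgaussianMGF.measure_sum_range_ge_le_of_iIndepFun (n := m) hX
      (fun i _ => hsub i) (ε := m * ε) (by positivity)
    have heq : Real.exp (-(m * ε) ^ 2 / (2 * m * c)) = q ^ m := by
      rw [hq, ← Real.exp_nat_mul]
      congr 1
      rcases Nat.eq_zero_or_pos m with rfl | hm
      · simp
      · field_simp
    rw [heq] at h
    rw [← ofReal_measureReal]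
    exact ENNReal.ofReal_le_ofReal h
  have hsum : ∑' m, P (s m) ≠ ⊤ := by
    refine ne_top_of_le_ne_top ?_ (ENNReal.tsum_le_tsum hbound)
    rw [← ENNReal.ofReal_tsum_of_nonneg (fun m => by positivity)
      (summable_geometric_of_lt_one (by positivity) hq1)]
    exact ENNReal.ofReal_ne_top
  filter_upwards [ae_eventually_notMem hsum] with ω hω
  filter_upwards [hω, eventually_gt_atTop 0] with m hm hm0
  have hm' : (0 : ℝ) < m := by exact_mod_cast hm0
  simp only [s, Set.mem_ofPred_eq, not_le] at hm
  rw [inv_mul_lt_iff₀ hm']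
  exact hm

/-- Strong law of large numbers for independent centered sub-Gaussian variables. -/
theorem ae_tendsto_average_of_hasSubgaussianMGF {Ω : Type*} [MeasurableSpace Ω] {P : Measure Ω}
    [IsProbabilityMeasure P] {X : ℕ → Ω → ℝ} (hX : iIndepFun X P) {c : ℝ≥0} (hc : 0 < c)
    (hsub : ∀ i, HasSubgaussianMGF (X i) c P) :
    ∀ᵐ ω ∂P, Tendsto (fun m : ℕ => (m : ℝ)⁻¹ * ∑ i ∈ Finset.range m, X i ω) atTop (𝓝 0) := by
  have hneg : iIndepFun (fun i => -X i) P :=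
    hX.comp (fun _ x => -x) (fun _ => measurable_neg)
  have h1 : ∀ᵐ ω ∂P, ∀ k : ℕ, ∀ᶠ m : ℕ in atTop,
      (m : ℝ)⁻¹ * ∑ i ∈ Finset.range m, X i ω < 1 / ((k : ℝ) + 1) :=
    ae_all_iff.2 fun k => ae_eventually_average_lt hX hc hsub (by positivity)
  have h2 : ∀ᵐ ω ∂P, ∀ k : ℕ, ∀ᶠ m : ℕ in atTop,
      (m : ℝ)⁻¹ * ∑ i ∈ Finset.range m, (-X i) ω < 1 / ((k : ℝ) + 1) :=
    ae_all_iff.2 fun k => ae_eventually_average_lt hneg hc (fun i => (hsub i).neg) (by positivity)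
  filter_upwards [h1, h2] with ω h1 h2
  rw [Metric.tendsto_nhds]
  intro ε hε
  obtain ⟨k, hk⟩ := exists_nat_one_div_lt hε
  filter_upwards [h1 k, h2 k] with m h1 h2
  simp only [Pi.neg_apply, Finset.sum_neg_distrib, mul_neg] at h2
  rw [Real.dist_eq, sub_zero, abs_lt]
  constructor <;> linarith

section Noise

variable {Ω : Type*} [MeasurableSpace Ω] {P : Measure Ω}
  {v : ℝ≥0} {r : ℕ → Ω → ℝ}

/-- Strong law of large numbers for i.i.d. centered Gaussian variables with bounded weights. -/
theorem ae_tendsto_weighted_average [IsProbabilityMeasure P] (hr : iIndepFun r P)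
    (hlaw : ∀ i, HasLaw (r i) (gaussianReal 0 v) P) {w : ℕ → ℝ} {C : ℝ} (hw : ∀ i, |w i| ≤ C) :
    ∀ᵐ ω ∂P, Tendsto (fun m : ℕ => (m : ℝ)⁻¹ * ∑ i ∈ Finset.range m, w i * r i ω) atTop
      (𝓝 0) := by
  have hX : iIndepFun (fun i ω => w i * r i ω) P :=
    hr.comp (fun i x => w i * x) (fun _ => measurable_const_mul _)
  -- The weighted noises are not identically distributed, but their variances are all at most `C ^ 2
  -- * v`. The added `1` keeps the parameter positive when `C` or `v` is zero.
  refine ae_tendsto_average_of_hasSubgaussianMGF hX (c := Real.toNNReal (C ^ 2 * v + 1))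
    (by rw [Real.toNNReal_pos]; positivity) fun i => ?_
  have hl := gaussianReal_const_mul (hlaw i) (w i)
  constructor
  · intro t
    have h := integrable_exp_mul_gaussianReal (μ := 0) (v := v) (t * w i)
    rw [← (hlaw i).map_eq] at h
    have h' := h.comp_aemeasurable (hlaw i).aemeasurable
    refine h'.congr (.of_forall fun ω => ?_)
    simp [mul_assoc]
  · intro t
    rw [mgf_gaussianReal hl.map_eq]
    rw [Real.exp_le_exp, Real.coe_toNNReal _ (by positivity)]
    have h1 : w i ^ 2 ≤ C ^ 2 := sq_le_sq' (by linarith [abs_le.1 (hw i)]) (abs_le.1 (hw i)).2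
    have h2 : w i ^ 2 * v ≤ C ^ 2 * v := mul_le_mul_of_nonneg_right h1 v.2
    simp only [NNReal.coe_mul, NNReal.coe_mk, mul_zero, zero_mul, zero_add]
    gcongr
    linarith

/-- The averages of the squares of i.i.d. Gaussian variables converge. -/
theorem ae_exists_tendsto_average_sq (hr : iIndepFun r P)
    (hlaw : ∀ i, HasLaw (r i) (gaussianReal 0 v) P) :
    ∀ᵐ ω ∂P, ∃ B : ℝ, Tendsto (fun m : ℕ => (m : ℝ)⁻¹ * ∑ i ∈ Finset.range m, r i ω ^ 2) atTop
      (𝓝 B) := by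
  have hint : Integrable (fun ω => r 0 ω ^ 2) P := by
    have h : MemLp id 2 (gaussianReal 0 v) := by
      simpa using memLp_id_gaussianReal (μ := 0) (v := v) 2
    have h2 := h.integrable_sq
    rw [← (hlaw 0).map_eq] at h2
    exact h2.comp_aemeasurable (hlaw 0).aemeasurable
  have h := strong_law_ae_real (μ := P) (fun i ω => r i ω ^ 2) hint
    (fun i j hij => (hr.indepFun hij).comp (φ := fun x => x ^ 2) (ψ := fun x => x ^ 2)
      (by fun_prop) (by fun_prop))
    (fun i => ((hlaw i).identDistrib (hlaw 0)).comp (u := fun x => x ^ 2) (by fun_prop))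
  filter_upwards [h] with ω hω
  refine ⟨_, hω.congr fun m => ?_⟩
  rw [div_eq_inv_mul]

end Noise

end

/-! ### Consistency for a fixed noise realization. -/

noncomputable section

variable {n : ℕ}

/-- The average of the first `m` terms of a real sequence. -/
def runningMean (p : ℕ → ℝ) (m : ℕ) : ℝ := (m : ℝ)⁻¹ * ∑ i ∈ Finset.range m, p i

theorem runningMean_mono {p q : ℕ → ℝ} (h : ∀ i, p i ≤ q i) (m : ℕ) : runningMean p m ≤ runningMean q m :=
  mul_le_mul_of_nonneg_left (Finset.sum_le_sum fun i _ => h i) (by positivity)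

theorem runningMean_add (p q : ℕ → ℝ) (m : ℕ) :
    runningMean (fun i => p i + q i) m = runningMean p m + runningMean q m := by
  simp [runningMean, Finset.sum_add_distrib, mul_add]

theorem runningMean_sub (p q : ℕ → ℝ) (m : ℕ) :
    runningMean (fun i => p i - q i) m = runningMean p m - runningMean q m := by
  simp [runningMean, Finset.sum_sub_distrib, mul_sub]

theorem runningMean_const_mul (c : ℝ) (p : ℕ → ℝ) (m : ℕ) :
    runningMean (fun i => c * p i) m = c * runningMean p m := by
  simp only [runningMean, ← Finset.mul_sum]
  ring

theorem runningMean_finset_sum {ι : Type*} (s : Finset ι) (p : ι → ℕ → ℝ) (m : ℕ) :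
    runningMean (fun i => ∑ k ∈ s, p k i) m = ∑ k ∈ s, runningMean (p k) m := by
  simp only [runningMean]
  rw [Finset.sum_comm, Finset.mul_sum]

theorem runningMean_const (c : ℝ) {m : ℕ} (hm : 0 < m) : runningMean (fun _ => c) m = c := by
  have : (m : ℝ) ≠ 0 := by positivity
  simp [runningMean, this]

theorem runningMean_const_le {c : ℝ} (hc : 0 ≤ c) (m : ℕ) : runningMean (fun _ => c) m ≤ c := by
  rcases Nat.eq_zero_or_pos m with rfl | hm
  · simpa [runningMean] using hc
  · exact (runningMean_const c hm).le

theorem abs_runningMean_le (p : ℕ → ℝ) (m : ℕ) : |runningMean p m| ≤ runningMean (fun i => |p i|) m := by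
  rw [runningMean, abs_mul, abs_of_nonneg (by positivity : (0 : ℝ) ≤ (m : ℝ)⁻¹)]
  exact mul_le_mul_of_nonneg_left (Finset.abs_sum_le_sum_abs _ _) (by positivity)

theorem runningMean_abs_le_of_runningMean_sq_le {ρ : ℕ → ℝ} {B : ℝ}
    (hB : ∀ m, runningMean (fun i => ρ i ^ 2) m ≤ B) (m : ℕ) :
    runningMean (fun i => |ρ i|) m ≤ 1 + B := by
  have h1 : ∀ i, |ρ i| ≤ 1 + ρ i ^ 2 := fun i => by
    nlinarith [sq_nonneg (|ρ i| - 1), sq_abs (ρ i)]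
  calc runningMean (fun i => |ρ i|) m ≤ runningMean (fun i => 1 + ρ i ^ 2) m := runningMean_mono h1 m
    _ = runningMean (fun _ => 1) m + runningMean (fun i => ρ i ^ 2) m := runningMean_add _ _ m
    _ ≤ 1 + B := add_le_add (runningMean_const_le zero_le_one m) (hB m)

variable {a : ℕ → EuclideanSpace ℝ (Fin n)} {xo : EuclideanSpace ℝ (Fin n)} {ρ : ℕ → ℝ} {B : ℝ}

/-- The Lipschitz constant does not depend on the sensor; this is what replaces a uniform law of
large numbers. -/
theorem abs_rangeSeq_sub_le (x y : EuclideanSpace ℝ (Fin n)) (i : ℕ) :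
    |rangeSeq a x i - rangeSeq a y i| ≤ ‖x - y‖ := by
  have h := abs_norm_sub_norm_le (a i - x) (a i - y)
  rw [sub_sub_sub_cancel_left, norm_sub_rev y x] at h
  exact h

/-- Weighted noise averages of the distance differences vanish in the limit at every point as soon
as they do on a dense set. -/
theorem tendsto_runningMean_noise_of_dense (hB : ∀ m, runningMean (fun i => ρ i ^ 2) m ≤ B)
    {D : Set (EuclideanSpace ℝ (Fin n))} (hD : Dense D)
    (hN : ∀ x ∈ D, Tendsto (runningMean fun i => (rangeSeq a x i - rangeSeq a xo i) * ρ i) atTop (𝓝 0))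
    (x : EuclideanSpace ℝ (Fin n)) :
    Tendsto (runningMean fun i => (rangeSeq a x i - rangeSeq a xo i) * ρ i) atTop (𝓝 0) := by
  have hB0 : 0 ≤ B := by simpa [runningMean] using hB 0
  rw [Metric.tendsto_nhds]
  intro ε hε
  obtain ⟨y, hy, hxy⟩ := Metric.dense_iff.1 hD x (ε / (2 * (1 + B))) (by positivity)
  rw [Metric.mem_ball, dist_eq_norm, norm_sub_rev, lt_div_iff₀ (by positivity)] at hy
  filter_upwards [Metric.tendsto_nhds.1 (hN y hxy) (ε / 2) (by positivity)] with m hm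
  rw [Real.dist_eq, sub_zero] at hm ⊢
  have h1 : runningMean (fun i => (rangeSeq a x i - rangeSeq a xo i) * ρ i) m
      = runningMean (fun i => (rangeSeq a y i - rangeSeq a xo i) * ρ i) m
        + runningMean (fun i => (rangeSeq a x i - rangeSeq a y i) * ρ i) m := by
    rw [← runningMean_add]
    congr 1
    funext i
    ring
  have h2 : |runningMean (fun i => (rangeSeq a x i - rangeSeq a y i) * ρ i) m| ≤ ‖x - y‖ * (1 + B) := by
    refine (abs_runningMean_le _ m).trans ?_
    refine (runningMean_mono (q := fun i => ‖x - y‖ * |ρ i|) (fun i => ?_) m).trans ?_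
    · rw [abs_mul]
      exact mul_le_mul_of_nonneg_right (abs_rangeSeq_sub_le x y i) (abs_nonneg _)
    · rw [runningMean_const_mul]
      exact mul_le_mul_of_nonneg_left (runningMean_abs_le_of_runningMean_sq_le hB m) (norm_nonneg _)
  rw [h1]
  have h3 := abs_add_le (runningMean (fun i => (rangeSeq a y i - rangeSeq a xo i) * ρ i) m)
    (runningMean (fun i => (rangeSeq a x i - rangeSeq a y i) * ρ i) m)
  linarith

/-- The basic inequality of nonlinear least squares. -/
theorem IsLSEstimate.runningMean_sq_le {Θ : Set (EuclideanSpace ℝ (Fin n))} (hxo : xo ∈ Θ) {m : ℕ}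
    {y : EuclideanSpace ℝ (Fin n)} (hy : IsLSEstimate Θ a (fun i => ‖a i - xo‖ + ρ i) m y) :
    runningMean (fun i => (rangeSeq a y i - rangeSeq a xo i) ^ 2) m
      ≤ 2 * runningMean (fun i => (rangeSeq a y i - rangeSeq a xo i) * ρ i) m := by
  have h : lsObjective a (fun i => ‖a i - xo‖ + ρ i) m y
      ≤ lsObjective a (fun i => ‖a i - xo‖ + ρ i) m xo := hy.2 hxo
  have h1 : runningMean (fun i => (‖a i - y‖ - (‖a i - xo‖ + ρ i)) ^ 2) m
      ≤ runningMean (fun i => (‖a i - xo‖ - (‖a i - xo‖ + ρ i)) ^ 2) m :=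
    mul_le_mul_of_nonneg_left h (by positivity)
  have h2 : runningMean (fun i => (‖a i - y‖ - (‖a i - xo‖ + ρ i)) ^ 2) m
      = runningMean (fun i => (rangeSeq a y i - rangeSeq a xo i) ^ 2) m
        - 2 * runningMean (fun i => (rangeSeq a y i - rangeSeq a xo i) * ρ i) m
        + runningMean (fun i => ρ i ^ 2) m := by
    rw [← runningMean_const_mul, ← runningMean_sub, ← runningMean_add]
    congr 1
    funext i
    simp only [rangeSeq]
    ring
  have h3 : runningMean (fun i => (‖a i - xo‖ - (‖a i - xo‖ + ρ i)) ^ 2) m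
      = runningMean (fun i => ρ i ^ 2) m := by
    congr 1
    funext i
    ring
  linarith

/-- Least squares estimates stay in a bounded set. -/
theorem IsLSEstimate.norm_sub_le {Θ : Set (EuclideanSpace ℝ (Fin n))} (hxo : xo ∈ Θ) {m : ℕ}
    (hm : 0 < m) {A : ℝ} (hA : ∀ i, ‖a i - xo‖ ≤ A)
    (hB : ∀ m, runningMean (fun i => ρ i ^ 2) m ≤ B)
    {y : EuclideanSpace ℝ (Fin n)} (hy : IsLSEstimate Θ a (fun i => ‖a i - xo‖ + ρ i) m y) :
    ‖y - xo‖ ≤ 2 * A + B + 1 := by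
  have hB0 : 0 ≤ B := by simpa [runningMean] using hB 0
  -- Young's inequality turns the basic inequality into a mean squared discrepancy of at most `4 *
  -- B`, while a distant estimate makes it exceed `(B + 1) ^ 2`. These conflict because `(B + 1) ^ 2
  -- - 4 * B = (B - 1) ^ 2`.
  by_contra! hlt
  have h1 := hy.runningMean_sq_le hxo
  have h2 : runningMean (fun i => (rangeSeq a y i - rangeSeq a xo i) * ρ i) m
      ≤ 1 / 4 * runningMean (fun i => (rangeSeq a y i - rangeSeq a xo i) ^ 2) m
        + runningMean (fun i => ρ i ^ 2) m := by
    rw [← runningMean_const_mul, ← runningMean_add]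
    refine runningMean_mono (fun i => ?_) m
    nlinarith [sq_nonneg ((rangeSeq a y i - rangeSeq a xo i) / 2 - ρ i)]
  have h3 : (‖y - xo‖ - 2 * A) ^ 2
      ≤ runningMean (fun i => (rangeSeq a y i - rangeSeq a xo i) ^ 2) m := by
    rw [← runningMean_const ((‖y - xo‖ - 2 * A) ^ 2) hm]
    refine runningMean_mono (fun i => ?_) m
    have h4 : ‖y - xo‖ ≤ ‖a i - y‖ + ‖a i - xo‖ := by
      rw [norm_sub_rev (a i) y]
      exact norm_sub_le_norm_sub_add_norm_sub y (a i) xo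
    have h5 : ‖y - xo‖ - 2 * A ≤ rangeSeq a y i - rangeSeq a xo i := by
      simp only [rangeSeq]
      linarith [hA i]
    exact pow_le_pow_left₀ (by linarith) h5 2
  have h4 : (B + 1) ^ 2 < (‖y - xo‖ - 2 * A) ^ 2 :=
    pow_lt_pow_left₀ (by linarith) (by linarith) two_ne_zero
  nlinarith [hB m, sq_nonneg (B - 1)]

/-- Strong consistency of least squares for a fixed noise realization. -/
theorem tendsto_of_isLSEstimate {A : ℝ} (hA : ∀ i, ‖a i - xo‖ ≤ A)
    (hB : ∀ m, runningMean (fun i => ρ i ^ 2) m ≤ B)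
    (hN : ∀ x, Tendsto (runningMean fun i => (rangeSeq a x i - rangeSeq a xo i) * ρ i) atTop (𝓝 0))
    {Θ : Set (EuclideanSpace ℝ (Fin n))} (hΘ : IsClosed Θ) (hxo : xo ∈ Θ)
    {Q : EuclideanSpace ℝ (Fin n) → ℝ}
    (hQ : ∀ x, Tendsto (runningMean fun i => (rangeSeq a x i - rangeSeq a xo i) ^ 2) atTop (𝓝 (Q x)))
    (hQpos : ∀ x ∈ Θ, x ≠ xo → 0 < Q x)
    {y : ℕ → EuclideanSpace ℝ (Fin n)}
    (hy : ∀ m, IsLSEstimate Θ a (fun i => ‖a i - xo‖ + ρ i) m (y m)) :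
    Tendsto y atTop (𝓝 xo) := by
  refine tendsto_of_subseq_tendsto fun ns hns => ?_
  have hK : IsCompact (Metric.closedBall xo (2 * A + B + 1) ∩ Θ) :=
    (isCompact_closedBall _ _).inter_right hΘ
  have hev : ∀ᶠ k in atTop, y (ns k) ∈ Metric.closedBall xo (2 * A + B + 1) ∩ Θ := by
    filter_upwards [hns.eventually_gt_atTop 0] with k hk
    refine ⟨?_, (hy _).1⟩
    rw [Metric.mem_closedBall, dist_eq_norm]
    exact (hy _).norm_sub_le hxo hk hA hB
  obtain ⟨z, hz, φ, hφ, hlim⟩ := hK.tendsto_subseq' hev.frequently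
  refine ⟨φ, ?_⟩
  have hk : Tendsto (fun j => ns (φ j)) atTop atTop := hns.comp hφ.tendsto_atTop
  suffices z = xo by rwa [this] at hlim
  by_contra hne
  refine absurd (hQpos z hz.2 hne) (not_lt.2 ?_)
  have he : Tendsto (fun j => ‖y (ns (φ j)) - z‖) atTop (𝓝 0) :=
    tendsto_iff_norm_sub_tendsto_zero.1 hlim
  -- Moving from `z` to the estimate costs a factor 2 and `2 * e ^ 2`; the basic inequality doubles
  -- again; moving the noise average back to `z` costs `4 * e * (1 + B)`. Everything in this bound
  -- vanishes along the subsequence.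
  have hup : Tendsto (fun j => 4 * runningMean (fun i => (rangeSeq a z i - rangeSeq a xo i) * ρ i)
      (ns (φ j)) + 4 * (‖y (ns (φ j)) - z‖ * (1 + B)) + 2 * ‖y (ns (φ j)) - z‖ ^ 2) atTop
      (𝓝 (4 * 0 + 4 * (0 * (1 + B)) + 2 * 0 ^ 2)) :=
    ((((hN z).comp hk).const_mul 4).add ((he.mul_const _).const_mul 4)).add ((he.pow 2).const_mul 2)
  have hle := le_of_tendsto_of_tendsto' ((hQ z).comp hk) hup fun j => ?_
  · simpa using hle
  set m := ns (φ j)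
  set e := ‖y m - z‖ with he_def
  have h1 := (hy m).runningMean_sq_le hxo
  have h2 : runningMean (fun i => (rangeSeq a z i - rangeSeq a xo i) ^ 2) m
      ≤ 2 * runningMean (fun i => (rangeSeq a (y m) i - rangeSeq a xo i) ^ 2) m
        + runningMean (fun _ => 2 * e ^ 2) m := by
    rw [← runningMean_const_mul, ← runningMean_add]
    refine runningMean_mono (fun i => ?_) m
    have h3 := abs_rangeSeq_sub_le (a := a) (y m) z i
    have h4 : (rangeSeq a (y m) i - rangeSeq a z i) ^ 2 ≤ e ^ 2 := by
      rw [← sq_abs]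
      exact pow_le_pow_left₀ (abs_nonneg _) h3 2
    nlinarith [sq_nonneg (2 * rangeSeq a (y m) i - rangeSeq a z i - rangeSeq a xo i)]
  have h3 : runningMean (fun _ => 2 * e ^ 2) m ≤ 2 * e ^ 2 := runningMean_const_le (by positivity) m
  have h4 : runningMean (fun i => (rangeSeq a (y m) i - rangeSeq a xo i) * ρ i) m
      ≤ runningMean (fun i => (rangeSeq a z i - rangeSeq a xo i) * ρ i) m
        + e * runningMean (fun i => |ρ i|) m := by
    rw [← runningMean_const_mul, ← runningMean_add]
    refine runningMean_mono (fun i => ?_) m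
    have h5 := abs_rangeSeq_sub_le (a := a) (y m) z i
    have h6 : (rangeSeq a (y m) i - rangeSeq a z i) * ρ i ≤ e * |ρ i| := by
      refine (le_abs_self _).trans ?_
      rw [abs_mul]
      exact mul_le_mul_of_nonneg_right h5 (abs_nonneg _)
    linarith
  have h5 : e * runningMean (fun i => |ρ i|) m ≤ e * (1 + B) :=
    mul_le_mul_of_nonneg_left (runningMean_abs_le_of_runningMean_sq_le hB m) (norm_nonneg _)
  simp only [Function.comp_apply]
  change runningMean (fun i => (rangeSeq a z i - rangeSeq a xo i) ^ 2) m ≤ _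
  linarith

end

/-! ### Taylor estimates for distances and the first-order condition. -/

noncomputable section

variable {n : ℕ}

section Expansion

variable {E : Type*} [NormedAddCommGroup E] [InnerProductSpace ℝ E]

theorem hasFDerivAt_norm_sub {a x : E} (h : a ≠ x) :
    HasFDerivAt (fun y => ‖a - y‖) (‖x - a‖⁻¹ • innerSL ℝ (x - a)) x := by
  have hpos : ‖x - a‖ ≠ 0 := by simpa [sub_eq_zero] using h.symm
  have h1 : HasFDerivAt (fun y => ‖y - a‖ ^ 2) (2 • innerSL ℝ (x - a)) x := by
    have := ((hasFDerivAt_id x).sub_const a).norm_sq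
    simpa using! this
  have h2 := h1.sqrt (by positivity)
  have h3 : (fun y => √(‖y - a‖ ^ 2)) = fun y => ‖a - y‖ := by
    funext y
    rw [Real.sqrt_sq (norm_nonneg _), norm_sub_rev]
  rw [h3] at h2
  convert h2 using 1
  rw [Real.sqrt_sq (norm_nonneg _)]
  ext z
  simp only [_root_.smul_apply, smul_eq_mul, nsmul_eq_mul]
  field_simp
  simp

/-- The remainder equals `(‖h‖ ^ 2 - (‖v + h‖ - ‖v‖) ^ 2) / (2 * ‖v‖)` exactly, so nothing is
required of the segment from `v` to `v + h`. -/
theorem abs_norm_add_sub_norm_sub_le {c : ℝ} (hc : 0 < c) {v h : E} (hv : c ≤ ‖v‖) :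
    |‖v + h‖ - ‖v‖ - ⟪v, h⟫_ℝ / ‖v‖| ≤ ‖h‖ ^ 2 / c := by
  have hs : 0 < ‖v‖ := hc.trans_le hv
  have h1 := norm_add_sq_real v h
  have h2 : |‖v + h‖ - ‖v‖| ≤ ‖h‖ := by
    simpa using abs_norm_sub_norm_le (v + h) v
  have h3 : (‖v + h‖ - ‖v‖) ^ 2 ≤ ‖h‖ ^ 2 := by
    rw [← sq_abs]
    exact pow_le_pow_left₀ (abs_nonneg _) h2 2
  have h4 : ‖v + h‖ - ‖v‖ - ⟪v, h⟫_ℝ / ‖v‖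
      = (‖h‖ ^ 2 - (‖v + h‖ - ‖v‖) ^ 2) / (2 * ‖v‖) := by
    field_simp
    nlinarith
  rw [h4, abs_of_nonneg (div_nonneg (by linarith) (by positivity))]
  refine div_le_div₀ (by positivity) ?_ hc (by linarith)
  nlinarith [sq_nonneg (‖v + h‖ - ‖v‖)]

theorem abs_inner_div_norm_le_norm (v e : E) : |⟪v, e⟫_ℝ / ‖v‖| ≤ ‖e‖ := by
  rw [abs_div, abs_norm]
  exact div_le_of_le_mul₀ (norm_nonneg _) (norm_nonneg _)
    ((abs_real_inner_le_norm v e).trans_eq (mul_comm _ _))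

theorem abs_inner_div_norm_sub_le {c : ℝ} (hc : 0 < c) {v h : E} (hv : c ≤ ‖v‖)
    (hvh : c ≤ ‖v + h‖) (e : E) :
    |⟪v + h, e⟫_ℝ / ‖v + h‖ - ⟪v, e⟫_ℝ / ‖v‖| ≤ 2 * ‖h‖ * ‖e‖ / c := by
  have hs : 0 < ‖v‖ := hc.trans_le hv
  have ht : 0 < ‖v + h‖ := hc.trans_le hvh
  have h2 : |‖v + h‖ - ‖v‖| ≤ ‖h‖ := by
    simpa using abs_norm_sub_norm_le (v + h) v
  have h4 : ⟪v + h, e⟫_ℝ / ‖v + h‖ - ⟪v, e⟫_ℝ / ‖v‖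
      = (⟪h, e⟫_ℝ - ⟪v, e⟫_ℝ / ‖v‖ * (‖v + h‖ - ‖v‖)) / ‖v + h‖ := by
    rw [inner_add_left]
    field_simp
    ring
  rw [h4, abs_div, abs_norm]
  refine div_le_div₀ (by positivity) ?_ hc hvh
  refine (abs_sub _ _).trans ?_
  rw [abs_mul]
  have h5 := abs_real_inner_le_norm h e
  have h6 := mul_le_mul (abs_inner_div_norm_le_norm v e) h2 (abs_nonneg _) (norm_nonneg _)
  linarith

/-- The subtracted linear term is the Hessian of the norm applied to `h` and `e`. Eliminating `⟪v,
h⟫_ℝ` through the two norms splits the remainder into three quadratic pieces, each bounded by `‖h‖ ^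
2 * ‖e‖ / c ^ 2`. -/
theorem abs_inner_div_norm_sub_sub_le {c : ℝ} (hc : 0 < c) {v h : E} (hv : c ≤ ‖v‖)
    (hvh : c ≤ ‖v + h‖) (e : E) :
    |⟪v + h, e⟫_ℝ / ‖v + h‖ - ⟪v, e⟫_ℝ / ‖v‖
      - (⟪h, e⟫_ℝ / ‖v‖ - ⟪v, e⟫_ℝ * ⟪v, h⟫_ℝ / ‖v‖ ^ 3)| ≤ 3 * ‖h‖ ^ 2 * ‖e‖ / c ^ 2 := by
  have hs : 0 < ‖v‖ := hc.trans_le hv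
  have ht : 0 < ‖v + h‖ := hc.trans_le hvh
  have h1 := norm_add_sq_real v h
  have h2 : |‖v + h‖ - ‖v‖| ≤ ‖h‖ := by
    simpa using abs_norm_sub_norm_le (v + h) v
  have h3 : (‖v + h‖ - ‖v‖) ^ 2 ≤ ‖h‖ ^ 2 := by
    rw [← sq_abs]
    exact pow_le_pow_left₀ (abs_nonneg _) h2 2
  have hp := abs_real_inner_le_norm h e
  have hq := abs_inner_div_norm_le_norm v e
  rw [inner_add_left]
  set s := ‖v‖
  set t := ‖v + h‖
  set k := ⟪v, h⟫_ℝ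
  set p := ⟪v, e⟫_ℝ
  set q := ⟪h, e⟫_ℝ
  have hk : k = (t ^ 2 - s ^ 2 - ‖h‖ ^ 2) / 2 := by linarith
  have h4 : (p + q) / t - p / s - (q / s - p * k / s ^ 3)
      = -(q * (t - s)) / (s * t) + p / s * ((t - s) ^ 2 / (s * t))
        + p / s * (((t - s) ^ 2 - ‖h‖ ^ 2) / 2 / s ^ 2) := by
    rw [hk]
    field_simp
    ring
  rw [h4]
  have hcc : 0 < c ^ 2 := by positivity
  have hst : c ^ 2 ≤ s * t := by nlinarith
  have hss : c ^ 2 ≤ s ^ 2 := by nlinarith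
  have b1 : |-(q * (t - s)) / (s * t)| ≤ ‖h‖ ^ 2 * ‖e‖ / c ^ 2 := by
    rw [abs_div, abs_neg, abs_mul, abs_of_pos (mul_pos hs ht)]
    refine div_le_div₀ (by positivity) ?_ hcc hst
    have := mul_le_mul hp h2 (abs_nonneg _) (by positivity)
    linarith
  have b2 : |p / s * ((t - s) ^ 2 / (s * t))| ≤ ‖e‖ * (‖h‖ ^ 2 / c ^ 2) := by
    rw [abs_mul]
    refine mul_le_mul hq ?_ (abs_nonneg _) (norm_nonneg _)
    rw [abs_of_nonneg (by positivity)]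
    exact div_le_div₀ (by positivity) h3 hcc hst
  have b3 : |p / s * (((t - s) ^ 2 - ‖h‖ ^ 2) / 2 / s ^ 2)| ≤ ‖e‖ * (‖h‖ ^ 2 / c ^ 2) := by
    rw [abs_mul]
    refine mul_le_mul hq ?_ (abs_nonneg _) (norm_nonneg _)
    rw [abs_div, abs_of_pos (by positivity : 0 < s ^ 2)]
    refine div_le_div₀ (by positivity) ?_ hcc hss
    rw [abs_le]
    constructor <;> nlinarith [sq_nonneg (t - s)]
  refine (abs_add_three _ _ _).trans ?_
  have : 3 * ‖h‖ ^ 2 * ‖e‖ / c ^ 2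
      = ‖h‖ ^ 2 * ‖e‖ / c ^ 2 + ‖e‖ * (‖h‖ ^ 2 / c ^ 2) + ‖e‖ * (‖h‖ ^ 2 / c ^ 2) := by ring
  linarith

end Expansion

variable {a : ℕ → EuclideanSpace ℝ (Fin n)} {xo : EuclideanSpace ℝ (Fin n)} {ρ : ℕ → ℝ} {B : ℝ}

theorem rangePartial_eq {x : EuclideanSpace ℝ (Fin n)} {i : ℕ} (h : a i ≠ x) (j : Fin n) :
    rangePartial a j x i = ⟪x - a i, EuclideanSpace.single j 1⟫_ℝ / ‖x - a i‖ := by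
  have := (hasFDerivAt_norm_sub h).fderiv
  simp only [rangePartial, rangeSeq]
  rw [this]
  simp [div_eq_inv_mul, inner_sub_left]

/-- First order condition for a least squares estimate in the interior of the search region. -/
theorem IsLSEstimate.runningMean_residual_eq_zero {Θ : Set (EuclideanSpace ℝ (Fin n))} {d : ℕ → ℝ}
    {m : ℕ} {y : EuclideanSpace ℝ (Fin n)} (hy : IsLSEstimate Θ a d m y) (hint : Θ ∈ 𝓝 y)
    (hne : ∀ i, a i ≠ y) (e : EuclideanSpace ℝ (Fin n)) :
    runningMean (fun i => (‖a i - y‖ - d i) * (⟪y - a i, e⟫_ℝ / ‖y - a i‖)) m = 0 := by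
  have hmin : IsLocalMin (lsObjective a d m) y := hy.2.isLocalMin hint
  have hd : HasFDerivAt (lsObjective a d m)
      (∑ i ∈ Finset.range m, (2 * (‖a i - y‖ - d i)) • (‖y - a i‖⁻¹ • innerSL ℝ (y - a i))) y := by
    unfold lsObjective
    refine HasFDerivAt.fun_sum fun i _ => ?_
    have := ((hasFDerivAt_norm_sub (hne i)).sub_const (d i)).pow 2
    simpa using! this
  have h0 := congrArg (fun L => L e) (hmin.hasFDerivAt_eq_zero hd)
  simp only [_root_.sum_apply, _root_.smul_apply, innerSL_apply_apply,
    smul_eq_mul, _root_.zero_apply] at h0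
  have h1 : ∑ i ∈ Finset.range m, (‖a i - y‖ - d i) * (⟪y - a i, e⟫_ℝ / ‖y - a i‖) = 0 := by
    have h2 : 2 * ∑ i ∈ Finset.range m, (‖a i - y‖ - d i) * (⟪y - a i, e⟫_ℝ / ‖y - a i‖) = 0 := by
      rw [← h0, Finset.mul_sum]
      refine Finset.sum_congr rfl fun i _ => ?_
      rw [div_eq_inv_mul]
      ring
    linarith
  rw [runningMean, h1, mul_zero]

end

/-! ### Approximate normal equations for the estimation error. -/

noncomputable section

variable {n : ℕ} {a : ℕ → EuclideanSpace ℝ (Fin n)} {xo : EuclideanSpace ℝ (Fin n)} {ρ : ℕ → ℝ}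
  {B : ℝ}

theorem inner_eq_sum_inner_single (v h : EuclideanSpace ℝ (Fin n)) :
    ⟪v, h⟫_ℝ = ∑ k, ⟪v, EuclideanSpace.single k 1⟫_ℝ * h k := by
  simp [PiLp.inner_apply, mul_comm]

/-- Linearization of the first order condition, with remainder terms collected on the right. -/
theorem abs_linearization_sub_le {c : ℝ} (hc : 0 < c) (hv : ∀ i, c ≤ ‖xo - a i‖)
    (hB : ∀ m, runningMean (fun i => ρ i ^ 2) m ≤ B) {m : ℕ} {y : EuclideanSpace ℝ (Fin n)}
    (hvy : ∀ i, c ≤ ‖y - a i‖) {e : EuclideanSpace ℝ (Fin n)} (he : ‖e‖ = 1)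
    (h0 : runningMean (fun i => (‖a i - y‖ - (‖a i - xo‖ + ρ i))
      * (⟪y - a i, e⟫_ℝ / ‖y - a i‖)) m = 0) :
    |runningMean (fun i => ⟪xo - a i, y - xo⟫_ℝ / ‖xo - a i‖ * (⟪xo - a i, e⟫_ℝ / ‖xo - a i‖)) m
      - runningMean (fun i => ⟪xo - a i, e⟫_ℝ / ‖xo - a i‖ * ρ i) m
      - runningMean (fun i => (⟪y - xo, e⟫_ℝ / ‖xo - a i‖
          - ⟪xo - a i, e⟫_ℝ * ⟪xo - a i, y - xo⟫_ℝ / ‖xo - a i‖ ^ 3) * ρ i) m|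
      ≤ (3 / c + 3 * (1 + B) / c ^ 2) * ‖y - xo‖ ^ 2 := by
  set h := y - xo with hh
  have hy : ∀ i, y - a i = (xo - a i) + h := fun i => by rw [hh]; abel
  rw [← runningMean_sub, ← runningMean_sub]
  -- Subtracting the vanishing first-order mean reduces the claim to a bound for each sensor
  -- separately.
  have hrw : runningMean (fun i => ⟪xo - a i, h⟫_ℝ / ‖xo - a i‖ * (⟪xo - a i, e⟫_ℝ / ‖xo - a i‖)
      - ⟪xo - a i, e⟫_ℝ / ‖xo - a i‖ * ρ i
      - (⟪h, e⟫_ℝ / ‖xo - a i‖ - ⟪xo - a i, e⟫_ℝ * ⟪xo - a i, h⟫_ℝ / ‖xo - a i‖ ^ 3) * ρ i) m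
      = runningMean (fun i => (⟪xo - a i, h⟫_ℝ / ‖xo - a i‖ * (⟪xo - a i, e⟫_ℝ / ‖xo - a i‖)
      - ⟪xo - a i, e⟫_ℝ / ‖xo - a i‖ * ρ i
      - (⟪h, e⟫_ℝ / ‖xo - a i‖ - ⟪xo - a i, e⟫_ℝ * ⟪xo - a i, h⟫_ℝ / ‖xo - a i‖ ^ 3) * ρ i)
      - (‖a i - y‖ - (‖a i - xo‖ + ρ i)) * (⟪y - a i, e⟫_ℝ / ‖y - a i‖)) m := by
    rw [runningMean_sub _ (fun i => (‖a i - y‖ - (‖a i - xo‖ + ρ i))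
      * (⟪y - a i, e⟫_ℝ / ‖y - a i‖)), h0, sub_zero]
  rw [hrw]
  refine (abs_runningMean_le _ m).trans ?_
  have hpt : ∀ i, |(⟪xo - a i, h⟫_ℝ / ‖xo - a i‖ * (⟪xo - a i, e⟫_ℝ / ‖xo - a i‖)
      - ⟪xo - a i, e⟫_ℝ / ‖xo - a i‖ * ρ i
      - (⟪h, e⟫_ℝ / ‖xo - a i‖ - ⟪xo - a i, e⟫_ℝ * ⟪xo - a i, h⟫_ℝ / ‖xo - a i‖ ^ 3) * ρ i)
      - (‖a i - y‖ - (‖a i - xo‖ + ρ i)) * (⟪y - a i, e⟫_ℝ / ‖y - a i‖)|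
      ≤ 3 / c * ‖h‖ ^ 2 + 3 / c ^ 2 * ‖h‖ ^ 2 * |ρ i| := by
    intro i
    have hvi := hv i
    have hvhi := hvy i
    rw [norm_sub_rev (a i) y, norm_sub_rev (a i) xo]
    rw [hy i] at hvhi ⊢
    set v := xo - a i
    have b1 := abs_norm_add_sub_norm_sub_le (h := h) hc hvi
    have b2 := abs_inner_div_norm_sub_le hc hvi hvhi e
    have b3 := abs_inner_div_norm_sub_sub_le hc hvi hvhi e
    have b4 := abs_inner_div_norm_le_norm (v + h) e
    have b5 := abs_inner_div_norm_le_norm v h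
    rw [he, mul_one] at b2 b3
    rw [he] at b4
    set U := ⟪v, h⟫_ℝ / ‖v‖
    set g := ⟪v, e⟫_ℝ / ‖v‖
    set G := ⟪v + h, e⟫_ℝ / ‖v + h‖
    set l := ⟪h, e⟫_ℝ / ‖v‖ - ⟪v, e⟫_ℝ * ⟪v, h⟫_ℝ / ‖v‖ ^ 3
    -- Each summand isolates one Taylor remainder; only the last multiplies the noise, and `1 + B`
    -- bounds the mean of `|ρ i|`.
    have hid : U * g - g * ρ i - l * ρ i - (‖v + h‖ - (‖v‖ + ρ i)) * G
        = -(U * (G - g)) + -((‖v + h‖ - ‖v‖ - U) * G) + (G - g - l) * ρ i := by ring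
    rw [hid]
    refine (abs_add_three _ _ _).trans ?_
    rw [abs_neg, abs_neg, abs_mul, abs_mul, abs_mul]
    have c1 := mul_le_mul b5 b2 (abs_nonneg _) (norm_nonneg _)
    have c2 := mul_le_mul b1 b4 (abs_nonneg _) (by positivity)
    have c3 := mul_le_mul_of_nonneg_right b3 (abs_nonneg (ρ i))
    calc _ ≤ ‖h‖ * (2 * ‖h‖ / c) + ‖h‖ ^ 2 / c * 1 + 3 * ‖h‖ ^ 2 / c ^ 2 * |ρ i| := by linarith
      _ = _ := by ring
  refine (runningMean_mono hpt m).trans ?_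
  rw [runningMean_add, runningMean_const_mul (3 / c ^ 2 * ‖h‖ ^ 2)]
  have d1 : runningMean (fun _ => 3 / c * ‖h‖ ^ 2) m ≤ 3 / c * ‖h‖ ^ 2 :=
    runningMean_const_le (by positivity) m
  have d2 := mul_le_mul_of_nonneg_left (runningMean_abs_le_of_runningMean_sq_le hB m)
    (by positivity : 0 ≤ 3 / c ^ 2 * ‖h‖ ^ 2)
  calc _ ≤ 3 / c * ‖h‖ ^ 2 + 3 / c ^ 2 * ‖h‖ ^ 2 * (1 + B) := add_le_add d1 d2
    _ = _ := by ring

/-- For a fixed noise realization, the error of least squares estimates solves the normal equations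
up to a term of smaller order. -/
theorem isLittleO_normal_equation {c : ℝ} (hc : 0 < c) (hv : ∀ i, c ≤ ‖xo - a i‖)
    (hB : ∀ m, runningMean (fun i => ρ i ^ 2) m ≤ B)
    {M : Matrix (Fin n) (Fin n) ℝ}
    (hM : ∀ j k, HasTailProduct (rangePartial a j xo) (rangePartial a k xo) (M j k))
    (hN₁ : Tendsto (runningMean fun i => ‖xo - a i‖⁻¹ * ρ i) atTop (𝓝 0))
    (hN₂ : ∀ j k, Tendsto (runningMean fun i =>
      rangePartial a j xo i * rangePartial a k xo i * ‖xo - a i‖⁻¹ * ρ i) atTop (𝓝 0))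
    {Θ : Set (EuclideanSpace ℝ (Fin n))} (hΘ : Θ ∈ 𝓝 xo) {y : ℕ → EuclideanSpace ℝ (Fin n)}
    (hy : ∀ m, IsLSEstimate Θ a (fun i => ‖a i - xo‖ + ρ i) m (y m))
    (hlim : Tendsto y atTop (𝓝 xo)) (j : Fin n) :
    (fun m => (∑ k, M j k * (y m - xo) k)
      - runningMean (fun i => rangePartial a j xo i * ρ i) m) =o[atTop] fun m => y m - xo := by
  have hne : ∀ i, a i ≠ xo := fun i h => by
    have := hv i
    rw [h, sub_self, norm_zero] at this
    linarith
  have hlim0 : Tendsto (fun m => y m - xo) atTop (𝓝 0) := tendsto_sub_nhds_zero_iff.2 hlim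
  have hcoord : ∀ k, (fun m => (y m - xo) k) =O[atTop] fun m => y m - xo := fun k =>
    Asymptotics.IsBigO.of_bound 1 (.of_forall fun m => by
      simpa using PiLp.norm_apply_le (y m - xo) k)
  have hsmall : ∀ (w : ℕ → ℝ) (k : Fin n), Tendsto w atTop (𝓝 0) →
      (fun m => w m * (y m - xo) k) =o[atTop] fun m => y m - xo := by
    intro w k hw
    have h1 := ((Asymptotics.isLittleO_one_iff ℝ).2 hw).mul_isBigO (hcoord k).norm_right
    simp only [one_mul] at h1
    exact h1.of_norm_right
  set R : ℕ → ℝ := fun m => runningMean (fun i => ⟪xo - a i, y m - xo⟫_ℝ / ‖xo - a i‖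
        * (⟪xo - a i, EuclideanSpace.single j 1⟫_ℝ / ‖xo - a i‖)) m
      - runningMean (fun i => ⟪xo - a i, EuclideanSpace.single j 1⟫_ℝ / ‖xo - a i‖ * ρ i) m
      - runningMean (fun i => (⟪y m - xo, EuclideanSpace.single j 1⟫_ℝ / ‖xo - a i‖
          - ⟪xo - a i, EuclideanSpace.single j 1⟫_ℝ * ⟪xo - a i, y m - xo⟫_ℝ
            / ‖xo - a i‖ ^ 3) * ρ i) m with hR
  have hRo : R =o[atTop] fun m => y m - xo := by
    have hO : R =O[atTop] fun m => ‖y m - xo‖ ^ 2 := by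
      refine Asymptotics.IsBigO.of_bound (3 / (c / 2) + 3 * (1 + B) / (c / 2) ^ 2) ?_
      -- By consistency the estimate is eventually interior to the search region, and within `c / 2`
      -- of `xo`, hence at least `c / 2` from every sensor.
      have hΘ' : ∀ᶠ m in atTop, Θ ∈ 𝓝 (y m) := hlim.eventually (eventually_mem_nhds_iff.2 hΘ)
      have hnear : ∀ᶠ m in atTop, ‖y m - xo‖ < c / 2 := by
        have := hlim0.norm
        rw [norm_zero] at this
        exact this.eventually_lt_const (by positivity)
      filter_upwards [hΘ', hnear] with m h1 h2
      have hvy : ∀ i, c / 2 ≤ ‖y m - a i‖ := fun i => by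
        have h3 := norm_sub_le_norm_sub_add_norm_sub xo (y m) (a i)
        rw [norm_sub_rev xo (y m)] at h3
        linarith [hv i]
      have hney : ∀ i, a i ≠ y m := fun i h => by
        have := hvy i
        rw [h, sub_self, norm_zero] at this
        linarith
      have h3 := abs_linearization_sub_le (half_pos hc) (fun i => (half_le_self hc.le).trans (hv i))
        hB hvy (e := EuclideanSpace.single j 1) (by simp)
        ((hy m).runningMean_residual_eq_zero h1 hney _)
      rw [norm_pow, norm_norm]
      exact h3
    refine hO.trans_isLittleO ?_
    have h1 : (fun m => ‖y m - xo‖) =o[atTop] fun _ => (1 : ℝ) := by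
      rw [Asymptotics.isLittleO_one_iff]
      simpa using hlim0.norm
    have h2 := h1.mul_isBigO (Asymptotics.isBigO_refl (fun m => ‖y m - xo‖) atTop)
    simp only [one_mul, ← sq] at h2
    exact h2.of_norm_right
  -- Besides `R`, every term is a coordinate of the error times a coefficient tending to zero: the
  -- Gram matrix error or a noise-weighted Hessian average.
  have hdecomp : (fun m => (∑ k, M j k * (y m - xo) k)
      - runningMean (fun i => rangePartial a j xo i * ρ i) m)
      = fun m => (∑ k, (M j k - runningMean
          (fun i => rangePartial a j xo i * rangePartial a k xo i) m) * (y m - xo) k)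
        + (R m + (runningMean (fun i => ‖xo - a i‖⁻¹ * ρ i) m * (y m - xo) j
        - ∑ k, runningMean (fun i => rangePartial a j xo i * rangePartial a k xo i
          * ‖xo - a i‖⁻¹ * ρ i) m * (y m - xo) k)) := by
    funext m
    have e1 : runningMean (fun i => ⟪xo - a i, y m - xo⟫_ℝ / ‖xo - a i‖
        * (⟪xo - a i, EuclideanSpace.single j 1⟫_ℝ / ‖xo - a i‖)) m
        = ∑ k, runningMean (fun i => rangePartial a j xo i * rangePartial a k xo i) m
          * (y m - xo) k := by
      have : ∀ k, runningMean (fun i => rangePartial a j xo i * rangePartial a k xo i) m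
          * (y m - xo) k = runningMean (fun i => (y m - xo) k
            * (rangePartial a j xo i * rangePartial a k xo i)) m := fun k => by
        rw [runningMean_const_mul, mul_comm]
      simp_rw [this]
      rw [← runningMean_finset_sum]
      congr 1
      funext i
      rw [inner_eq_sum_inner_single, Finset.sum_div, Finset.sum_mul]
      refine Finset.sum_congr rfl fun k _ => ?_
      rw [rangePartial_eq (hne i), rangePartial_eq (hne i)]
      ring
    have e2 : runningMean (fun i => (⟪y m - xo, EuclideanSpace.single j 1⟫_ℝ / ‖xo - a i‖
          - ⟪xo - a i, EuclideanSpace.single j 1⟫_ℝ * ⟪xo - a i, y m - xo⟫_ℝ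
            / ‖xo - a i‖ ^ 3) * ρ i) m
        = runningMean (fun i => ‖xo - a i‖⁻¹ * ρ i) m * (y m - xo) j
        - ∑ k, runningMean (fun i => rangePartial a j xo i * rangePartial a k xo i
          * ‖xo - a i‖⁻¹ * ρ i) m * (y m - xo) k := by
      have : ∀ k, runningMean (fun i => rangePartial a j xo i * rangePartial a k xo i
          * ‖xo - a i‖⁻¹ * ρ i) m * (y m - xo) k = runningMean (fun i => (y m - xo) k
            * (rangePartial a j xo i * rangePartial a k xo i * ‖xo - a i‖⁻¹ * ρ i)) m := fun k => by
        rw [runningMean_const_mul, mul_comm]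
      simp_rw [this]
      rw [← runningMean_finset_sum, mul_comm, ← runningMean_const_mul, ← runningMean_sub]
      congr 1
      funext i
      have e3 : ⟪y m - xo, EuclideanSpace.single j 1⟫_ℝ = (y m - xo) j := by
        simp [EuclideanSpace.inner_single_right]
      rw [e3, inner_eq_sum_inner_single (xo - a i) (y m - xo), sub_mul, Finset.mul_sum,
        Finset.sum_div, Finset.sum_mul]
      congr 1
      · ring
      · refine Finset.sum_congr rfl fun k _ => ?_
        rw [rangePartial_eq (hne i), rangePartial_eq (hne i)]
        ring
    have e4 : runningMean (fun i => ⟪xo - a i, EuclideanSpace.single j 1⟫_ℝ / ‖xo - a i‖ * ρ i) m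
        = runningMean (fun i => rangePartial a j xo i * ρ i) m := by
      congr 1
      funext i
      rw [rangePartial_eq (hne i)]
    simp only [hR]
    rw [e1, e2, e4]
    simp only [sub_mul, Finset.sum_sub_distrib]
    ring
  rw [hdecomp]
  refine Asymptotics.IsLittleO.add (Asymptotics.IsLittleO.fun_sum fun k _ => ?_)
    (hRo.add (Asymptotics.IsLittleO.sub (hsmall _ _ hN₁)
      (Asymptotics.IsLittleO.fun_sum fun k _ => hsmall _ _ (hN₂ j k))))
  refine hsmall _ k ?_
  have h1 : Tendsto (runningMean fun i => rangePartial a j xo i * rangePartial a k xo i) atTop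
      (𝓝 (M j k)) := hM j k
  simpa using h1.const_sub (M j k)

end

/-! ### Identifiability and nondegeneracy from the hyperplane conditions. -/

noncomputable section

variable {n : ℕ}

theorem isAffineHyperplane_of_direction_eq {S : AffineSubspace ℝ (EuclideanSpace ℝ (Fin n))}
    (hS : (S : Set (EuclideanSpace ℝ (Fin n))).Nonempty) {w : EuclideanSpace ℝ (Fin n)}
    (hw : w ≠ 0) (hdir : S.direction = (Submodule.span ℝ {w})ᗮ) : IsAffineHyperplane S := by
  refine ⟨hS, ?_⟩
  have h := Submodule.finrank_add_finrank_orthogonal (Submodule.span ℝ {w})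
  rw [finrank_span_singleton hw, finrank_euclideanSpace_fin] at h
  rw [hdir]
  omega

theorem measure_eq_one_of_ae_mem {α : Type*} [MeasurableSpace α] {μ : Measure α}
    [IsProbabilityMeasure μ] {S : Set α} (h : ∀ᵐ y ∂μ, y ∈ S) : μ S = 1 := by
  rw [measure_eq_measure_of_null_sdiff (Set.subset_univ S), measure_univ]
  rw [← Set.compl_eq_univ_sdiff]
  exact h

variable {a : ℕ → EuclideanSpace ℝ (Fin n)} {xo : EuclideanSpace ℝ (Fin n)}
  {μ : Measure (EuclideanSpace ℝ (Fin n))}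

/-- The mean squared discrepancy between the distances to `x` and to `xo`. -/
def meanSqDiscrepancy (μ : Measure (EuclideanSpace ℝ (Fin n))) (xo x : EuclideanSpace ℝ (Fin n)) :
    ℝ :=
  ∫ y, (‖y - x‖ - ‖y - xo‖) ^ 2 ∂μ

theorem abs_sq_norm_sub_norm_le (xo x y : EuclideanSpace ℝ (Fin n)) :
    |(‖y - x‖ - ‖y - xo‖) ^ 2| ≤ ‖x - xo‖ ^ 2 := by
  rw [abs_pow]
  refine pow_le_pow_left₀ (abs_nonneg _) ?_ 2
  have h := abs_norm_sub_norm_le (y - x) (y - xo)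
  rw [sub_sub_sub_cancel_left, norm_sub_rev xo x] at h
  exact h

theorem SampleCDFTendsto.hasTailProduct_rangeSeq_sub [IsProbabilityMeasure μ]
    (h : SampleCDFTendsto a μ) (xo x : EuclideanSpace ℝ (Fin n)) :
    HasTailProduct (rangeSeq a x - rangeSeq a xo) (rangeSeq a x - rangeSeq a xo)
      (meanSqDiscrepancy μ xo x) := by
  have := h.tendsto_average (φ := fun y => (‖y - x‖ - ‖y - xo‖) ^ 2) (by fun_prop)
    (abs_sq_norm_sub_norm_le xo x)
  refine this.congr fun t => ?_
  simp [rangeSeq, sq]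

theorem meanSqDiscrepancy_nonneg (xo x : EuclideanSpace ℝ (Fin n)) :
    0 ≤ meanSqDiscrepancy μ xo x :=
  integral_nonneg fun _ => sq_nonneg _

theorem SampleCDFTendsto.sq_tailNorm_rangeSeq_sub [IsProbabilityMeasure μ]
    (h : SampleCDFTendsto a μ) (xo x : EuclideanSpace ℝ (Fin n)) :
    tailNorm (rangeSeq a x - rangeSeq a xo) ^ 2 = meanSqDiscrepancy μ xo x := by
  rw [tailNorm, (h.hasTailProduct_rangeSeq_sub xo x).tailProduct_eq,
    Real.sq_sqrt (meanSqDiscrepancy_nonneg xo x)]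

theorem AsymptoticallyUniquelyLocalizable.meanSqDiscrepancy_pos [IsProbabilityMeasure μ]
    {Θ : Set (EuclideanSpace ℝ (Fin n))} (hloc : AsymptoticallyUniquelyLocalizable Θ a xo)
    (h : SampleCDFTendsto a μ) {x : EuclideanSpace ℝ (Fin n)} (hx : x ∈ Θ) (hne : x ≠ xo) :
    0 < meanSqDiscrepancy μ xo x := by
  have := hloc x hx hne
  rw [h.sq_tailNorm_rangeSeq_sub, h.sq_tailNorm_rangeSeq_sub] at this
  exact (meanSqDiscrepancy_nonneg xo xo).trans_lt this

/-- If no hyperplane carries `μ`, then distances to the sensors identify the object. -/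
theorem meanSqDiscrepancy_pos_of_not_hyperplane [IsProbabilityMeasure μ]
    (hμ : ¬ ∃ S : AffineSubspace ℝ (EuclideanSpace ℝ (Fin n)),
      IsAffineHyperplane S ∧ μ (S : Set (EuclideanSpace ℝ (Fin n))) = 1)
    {x : EuclideanSpace ℝ (Fin n)} (hne : x ≠ xo) : 0 < meanSqDiscrepancy μ xo x := by
  refine (meanSqDiscrepancy_nonneg xo x).lt_of_ne' fun h0 => hμ ?_
  have hint : Integrable (fun y => (‖y - x‖ - ‖y - xo‖) ^ 2) μ :=
    Integrable.of_bound (by fun_prop) (‖x - xo‖ ^ 2)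
      (.of_forall fun y => abs_sq_norm_sub_norm_le xo x y)
  have hae := (integral_eq_zero_iff_of_nonneg (fun _ => sq_nonneg _) hint).1 h0
  -- Zero mean discrepancy makes almost every sensor location equidistant from `x` and `xo`.
  refine ⟨AffineSubspace.perpBisector x xo, isAffineHyperplane_of_direction_eq
    AffineSubspace.perpBisector_nonempty (w := xo - x) (sub_ne_zero.2 hne.symm)
    (by simp [AffineSubspace.direction_perpBisector]), measure_eq_one_of_ae_mem ?_⟩
  filter_upwards [hae] with y hy
  simp only [Pi.zero_apply, ne_eq, OfNat.ofNat_ne_zero, not_false_eq_true, pow_eq_zero_iff] at hy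
  rw [SetLike.mem_coe, AffineSubspace.mem_perpBisector_iff_dist_eq, dist_eq_norm, dist_eq_norm]
  linarith

/-- The product of two direction cosines, regularized at distances smaller than `c`. -/
def cosineProduct (xo : EuclideanSpace ℝ (Fin n)) (c : ℝ) (j k : Fin n)
    (y : EuclideanSpace ℝ (Fin n)) : ℝ :=
  (xo j - y j) * (xo k - y k) / max (‖xo - y‖ ^ 2) (c ^ 2)

theorem continuous_cosineProduct {c : ℝ} (hc : 0 < c) (j k : Fin n) :
    Continuous (cosineProduct xo c j k) := by
  unfold cosineProduct
  refine Continuous.div (by fun_prop) (by fun_prop) fun y => ?_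
  have : 0 < max (‖xo - y‖ ^ 2) (c ^ 2) := lt_max_of_lt_right (by positivity)
  exact this.ne'

theorem abs_cosineProduct_le (c : ℝ) (j k : Fin n) (y : EuclideanSpace ℝ (Fin n)) :
    |cosineProduct xo c j k y| ≤ 1 := by
  have h : ∀ j, |xo j - y j| ≤ ‖xo - y‖ := fun j => by
    simpa using PiLp.norm_apply_le (xo - y) j
  have h0 : 0 ≤ max (‖xo - y‖ ^ 2) (c ^ 2) := le_max_of_le_left (by positivity)
  rw [cosineProduct, abs_div, abs_mul, abs_of_nonneg h0]
  refine div_le_one_of_le₀ (le_max_of_le_left ?_) h0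
  rw [sq]
  exact mul_le_mul (h j) (h k) (abs_nonneg _) (norm_nonneg _)

/-- The limiting Gram matrix of the partial derivatives of the distances. -/
def gramLimit (μ : Measure (EuclideanSpace ℝ (Fin n))) (xo : EuclideanSpace ℝ (Fin n)) (c : ℝ) :
    Matrix (Fin n) (Fin n) ℝ :=
  Matrix.of fun j k => ∫ y, cosineProduct xo c j k y ∂μ

/-- At the sensors the regularization is inactive, while off them it provides the continuity at `xo`
that weak convergence needs. -/
theorem rangePartial_mul_rangePartial {c : ℝ} (hc : 0 < c) (hv : ∀ i, c ≤ ‖xo - a i‖)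
    (j k : Fin n) (i : ℕ) :
    rangePartial a j xo i * rangePartial a k xo i = cosineProduct xo c j k (a i) := by
  have hne : a i ≠ xo := fun h => by
    have := hv i
    rw [h, sub_self, norm_zero] at this
    linarith
  rw [rangePartial_eq hne, rangePartial_eq hne, cosineProduct,
    max_eq_left (pow_le_pow_left₀ hc.le (hv i) 2)]
  have hs : ‖xo - a i‖ ≠ 0 := (hc.trans_le (hv i)).ne'
  simp only [EuclideanSpace.inner_single_right]
  simp
  field_simp

theorem SampleCDFTendsto.hasTailProduct_rangePartial [IsProbabilityMeasure μ]
    (h : SampleCDFTendsto a μ) {c : ℝ} (hc : 0 < c) (hv : ∀ i, c ≤ ‖xo - a i‖) (j k : Fin n) :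
    HasTailProduct (rangePartial a j xo) (rangePartial a k xo) (gramLimit μ xo c j k) := by
  refine (h.tendsto_average (continuous_cosineProduct hc j k)
    (abs_cosineProduct_le c j k)).congr fun t => ?_
  simp only [rangePartial_mul_rangePartial hc hv]

/-- If no hyperplane through `xo` carries `μ`, then the limiting Gram matrix is positive definite. -/
theorem posDef_gramLimit [IsProbabilityMeasure μ] {c : ℝ} (hc : 0 < c)
    (hμ : ¬ ∃ S : AffineSubspace ℝ (EuclideanSpace ℝ (Fin n)),
      IsAffineHyperplane S ∧ xo ∈ S ∧ μ (S : Set (EuclideanSpace ℝ (Fin n))) = 1) :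
    (gramLimit μ xo c).PosDef := by
  have hint : ∀ j k, Integrable (cosineProduct xo c j k) μ := fun j k =>
    Integrable.of_bound (continuous_cosineProduct hc j k).aestronglyMeasurable 1
      (.of_forall fun y => abs_cosineProduct_le c j k y)
  refine Matrix.PosDef.of_dotProduct_mulVec_pos ?_ fun t ht => ?_
  · ext j k
    simp only [gramLimit, Matrix.conjTranspose_apply, Matrix.of_apply, star_trivial]
    refine integral_congr_ae (.of_forall fun y => ?_)
    simp only [cosineProduct]
    ring
  have hquad : ∀ y, ∑ j, ∑ k, t j * t k * cosineProduct xo c j k y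
      = (∑ j, t j * (xo j - y j)) ^ 2 / max (‖xo - y‖ ^ 2) (c ^ 2) := fun y => by
    rw [sq, Finset.sum_mul_sum, Finset.sum_div]
    refine Finset.sum_congr rfl fun j _ => ?_
    rw [Finset.sum_div]
    refine Finset.sum_congr rfl fun k _ => ?_
    rw [cosineProduct]
    ring
  have hform : star t ⬝ᵥ gramLimit μ xo c *ᵥ t
      = ∫ y, ∑ j, ∑ k, t j * t k * cosineProduct xo c j k y ∂μ := by
    rw [integral_finsetSum _ fun j _ => integrable_finsetSum _ fun k _ =>
      (hint j k).const_mul _]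
    simp only [dotProduct, Matrix.mulVec, gramLimit, Matrix.of_apply, star_trivial]
    refine Finset.sum_congr rfl fun j _ => ?_
    rw [integral_finsetSum _ fun k _ => (hint j k).const_mul _, Finset.mul_sum]
    refine Finset.sum_congr rfl fun k _ => ?_
    rw [integral_const_mul]
    ring
  have hmax : ∀ y, 0 < max (‖xo - y‖ ^ 2) (c ^ 2) := fun y =>
    lt_max_of_lt_right (by positivity)
  have hnonneg : ∀ y, 0 ≤ ∑ j, ∑ k, t j * t k * cosineProduct xo c j k y := fun y => by
    rw [hquad]
    exact div_nonneg (sq_nonneg _) (hmax y).le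
  rw [hform]
  refine (integral_nonneg hnonneg).lt_of_ne' fun h0 => hμ ?_
  have hae := (integral_eq_zero_iff_of_nonneg hnonneg (integrable_finsetSum _ fun j _ =>
    integrable_finsetSum _ fun k _ => (hint j k).const_mul _)).1 h0
  have hw : WithLp.toLp 2 t ≠ (0 : EuclideanSpace ℝ (Fin n)) := by
    simpa using ht
  -- The denominator never vanishes, so a null quadratic form forces `y - xo` to be orthogonal to
  -- `t` almost everywhere.
  refine ⟨AffineSubspace.mk' xo (Submodule.span ℝ {WithLp.toLp 2 t})ᗮ,
    isAffineHyperplane_of_direction_eq ⟨xo, AffineSubspace.self_mem_mk' _ _⟩ hw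
      (AffineSubspace.direction_mk' _ _), AffineSubspace.self_mem_mk' _ _,
    measure_eq_one_of_ae_mem ?_⟩
  filter_upwards [hae] with y hy
  rw [hquad] at hy
  simp only [Pi.zero_apply, div_eq_zero_iff, (hmax y).ne', or_false, ne_eq, OfNat.ofNat_ne_zero,
    not_false_eq_true, pow_eq_zero_iff] at hy
  rw [SetLike.mem_coe, AffineSubspace.mem_mk', Submodule.mem_orthogonal_singleton_iff_inner_right]
  have : ⟪WithLp.toLp 2 t, y -ᵥ xo⟫_ℝ = -∑ j, t j * (xo j - y j) := by
    simp only [PiLp.inner_apply, vsub_eq_sub, PiLp.sub_apply, ← Finset.sum_neg_distrib]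
    refine Finset.sum_congr rfl fun j _ => ?_
    simp
    ring
  rw [this, hy, neg_zero]

end

/-! ### Central limit theorem and transfer to the estimator. -/

noncomputable section

variable {n : ℕ} {Ω : Type*} [MeasurableSpace Ω] {P : Measure Ω}
  {v : ℝ≥0} {r : ℕ → Ω → ℝ}

theorem charFun_map_gaussian_smul {X : Ω → ℝ} (hX : HasLaw X (gaussianReal 0 v) P)
    (u t : EuclideanSpace ℝ (Fin n)) :
    charFun (P.map fun ω => X ω • u) t = Complex.exp (-((v : ℝ) * ⟪u, t⟫_ℝ ^ 2 / 2 : ℝ)) := by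
  have hm := hX.aemeasurable
  have h1 : charFun (P.map fun ω => X ω • u) t = charFun (P.map X) ⟪u, t⟫_ℝ := by
    rw [charFun_apply, charFun_apply_real, integral_map (by fun_prop) (by fun_prop),
      integral_map (by fun_prop) (by fun_prop)]
    refine integral_congr_ae (.of_forall fun ω => ?_)
    simp only [real_inner_smul_left]
    push_cast
    ring_nf
  rw [h1, hX.map_eq, charFun_gaussianReal]
  congr 1
  push_cast
  ring

/-- Central limit theorem for weighted sums of i.i.d. centered Gaussian variables with vector
weights. -/
theorem tendstoInDistribution_weighted_sum [IsProbabilityMeasure P] (hr : iIndepFun r P)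
    (hlaw : ∀ i, HasLaw (r i) (gaussianReal 0 v) P) {W : ℕ → EuclideanSpace ℝ (Fin n)}
    {S : Matrix (Fin n) (Fin n) ℝ} (hS : S.PosSemidef)
    (hW : ∀ t : EuclideanSpace ℝ (Fin n),
      Tendsto (runningMean fun i => ⟪W i, t⟫_ℝ ^ 2) atTop (𝓝 (t ⬝ᵥ S *ᵥ t))) :
    TendstoInDistribution (fun (m : ℕ) ω => (√(m : ℝ))⁻¹ • ∑ i ∈ Finset.range m, r i ω • W i)
      atTop id (fun _ => P) (multivariateGaussian 0 ((v : ℝ) • S)) := by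
  have hm : ∀ i, AEMeasurable (r i) P := fun i => (hlaw i).aemeasurable
  have hmeas : ∀ m : ℕ, AEMeasurable
      (fun ω => (√(m : ℝ))⁻¹ • ∑ i ∈ Finset.range m, r i ω • W i) P := fun m => by fun_prop
  refine ⟨hmeas, by fun_prop, ?_⟩
  refine ProbabilityMeasure.tendsto_of_tendsto_charFun fun t => ?_
  have hvS : ((v : ℝ) • S).PosSemidef := hS.smul v.2
  have hlim : charFun ((multivariateGaussian 0 ((v : ℝ) • S)).map id) t
      = Complex.exp (-((v : ℝ) * (t ⬝ᵥ S *ᵥ t) / 2 : ℝ)) := by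
    rw [Measure.map_id, charFun_multivariateGaussian hvS]
    congr 1
    simp [Matrix.smul_mulVec]
  -- Gaussian noise makes the characteristic function explicit at every finite `m`, so no Lindeberg
  -- condition enters.
  have hseq : ∀ m : ℕ, charFun (P.map fun ω => (√(m : ℝ))⁻¹ • ∑ i ∈ Finset.range m, r i ω • W i) t
      = Complex.exp (-((v : ℝ) * runningMean (fun i => ⟪W i, t⟫_ℝ ^ 2) m / 2 : ℝ)) := by
    intro m
    have h1 : (fun ω => (√(m : ℝ))⁻¹ • ∑ i ∈ Finset.range m, r i ω • W i)
        = fun ω => ∑ i ∈ Finset.range m, r i ω • ((√(m : ℝ))⁻¹ • W i) := by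
      funext ω
      rw [Finset.smul_sum]
      exact Finset.sum_congr rfl fun i _ => smul_comm _ _ _
    have hind : iIndepFun (fun i ω => r i ω • ((√(m : ℝ))⁻¹ • W i)) P :=
      hr.comp (fun i x => x • ((√(m : ℝ))⁻¹ • W i)) (fun i => by fun_prop)
    rw [h1, iIndepFun.charFun_map_fun_finsetSum_eq_prod (s := Finset.range m)
      (X := fun i ω => r i ω • ((√(m : ℝ))⁻¹ • W i)) (fun i _ => by fun_prop)
      (hind.precomp (g := fun i : Finset.range m => (i : ℕ)) Subtype.val_injective),
      Finset.prod_apply]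
    simp_rw [charFun_map_gaussian_smul (hlaw _)]
    rw [← Complex.exp_sum]
    congr 1
    rw [Finset.sum_neg_distrib, ← Complex.ofReal_sum]
    congr 2
    rw [runningMean, ← Finset.sum_div, ← Finset.mul_sum]
    congr 2
    rw [Finset.mul_sum]
    refine Finset.sum_congr rfl fun i _ => ?_
    rw [real_inner_smul_left, mul_pow, inv_pow, Real.sq_sqrt (by positivity)]
  change Tendsto (fun m : ℕ => charFun (P.map fun ω =>
    (√(m : ℝ))⁻¹ • ∑ i ∈ Finset.range m, r i ω • W i) t) atTop
    (𝓝 (charFun ((multivariateGaussian 0 ((v : ℝ) • S)).map id) t))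
  rw [hlim]
  simp_rw [hseq]
  have hc : Continuous fun x : ℝ => Complex.exp (-((v : ℝ) * x / 2 : ℝ)) := by fun_prop
  exact (hc.tendsto _).comp (hW t)

/-- A sequence which differs from a sequence converging in distribution by an almost surely
negligible fraction of the latter has the same limit. -/
theorem MeasureTheory.TendstoInDistribution.of_ae_isLittleO [IsProbabilityMeasure P]
    {X Y : ℕ → Ω → EuclideanSpace ℝ (Fin n)}
    {Ω' : Type*} [MeasurableSpace Ω'] {P' : Measure Ω'} [IsProbabilityMeasure P']
    {Z : Ω' → EuclideanSpace ℝ (Fin n)}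
    (hY : TendstoInDistribution Y atTop Z (fun _ => P) P') (hX : ∀ m, AEMeasurable (X m) P)
    (h : ∀ᵐ ω ∂P, (fun m => X m ω - Y m ω) =o[atTop] fun m => Y m ω) :
    TendstoInDistribution X atTop Z (fun _ => P) P' := by
  have hYm := hY.forall_aemeasurable
  -- The normalized difference tends to zero almost surely without any bound on `Y`. Then `X = Y +
  -- (1 + ‖Y‖) • T` is a continuous image of the pair, to which Slutsky's theorem applies.
  set T : ℕ → Ω → EuclideanSpace ℝ (Fin n) := fun m ω =>
    (1 + ‖Y m ω‖)⁻¹ • (X m ω - Y m ω) with hT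
  have hTm : ∀ m, AEMeasurable (T m) P := fun m =>
    ((hYm m).norm.const_add 1).inv.smul ((hX m).sub (hYm m))
  have hT0 : TendstoInMeasure P T atTop (fun _ => 0) := by
    refine tendstoInMeasure_of_tendsto_ae (fun m => (hTm m).aestronglyMeasurable) ?_
    filter_upwards [h] with ω hω
    have h1 : (fun m => Y m ω) =O[atTop] fun m => 1 + ‖Y m ω‖ :=
      Asymptotics.IsBigO.of_bound 1 (.of_forall fun m => by
        rw [one_mul, Real.norm_of_nonneg (by positivity)]
        linarith)
    exact (hω.trans_isBigO h1).tendsto_inv_smul_nhds_zero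
  have hg : Continuous fun p : EuclideanSpace ℝ (Fin n) × EuclideanSpace ℝ (Fin n) =>
      p.1 + (1 + ‖p.1‖) • p.2 := by fun_prop
  have := hY.continuous_comp_prodMk_of_tendstoInMeasure_const hg hT0 hTm
  refine TendstoInDistribution.congr (fun m => .of_forall fun ω => ?_) (.of_forall fun ω => ?_) this
  · have hne : (1 + ‖Y m ω‖) ≠ 0 := by positivity
    simp only [hT]
    rw [smul_inv_smul₀ hne]
    abel
  · simp

/-- Applying `M⁻¹` gives an error of order `o(h)`. Symmetry of asymptotic equivalence converts it to
an error relative to the explicit main term, so no convergence rate for `h` need be known in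
advance. -/
theorem isLittleO_sub_of_normal_equation {M : Matrix (Fin n) (Fin n) ℝ} (hM : IsUnit M)
    {h : ℕ → EuclideanSpace ℝ (Fin n)} {z : ℕ → Fin n → ℝ}
    (hz : ∀ j, (fun m => (∑ k, M j k * h m k) - z m j) =o[atTop] h) :
    (fun m => h m - WithLp.toLp 2 (M⁻¹ *ᵥ z m)) =o[atTop]
      fun m => (WithLp.toLp 2 (M⁻¹ *ᵥ z m) : EuclideanSpace ℝ (Fin n)) := by
  have h1 : (fun m => M *ᵥ (h m) - z m) =o[atTop] h := Asymptotics.isLittleO_pi.2 hz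
  let L : (Fin n → ℝ) →L[ℝ] EuclideanSpace ℝ (Fin n) :=
    LinearMap.toContinuousLinearMap
      ((WithLp.linearEquiv 2 ℝ (Fin n → ℝ)).symm.toLinearMap ∘ₗ Matrix.mulVecLin M⁻¹)
  have hL : ∀ w, L w = WithLp.toLp 2 (M⁻¹ *ᵥ w) := fun w => rfl
  have h2 := (L.isBigO_comp (fun m => M *ᵥ (h m) - z m) atTop).trans_isLittleO h1
  have h3 : ∀ m, L (M *ᵥ (h m) - z m) = h m - WithLp.toLp 2 (M⁻¹ *ᵥ z m) := fun m => by
    rw [hL, Matrix.mulVec_sub, Matrix.mulVec_mulVec,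
      Matrix.nonsing_inv_mul _ ((Matrix.isUnit_iff_isUnit_det M).1 hM), Matrix.one_mulVec]
    rfl
  simp_rw [h3] at h2
  have h4 : Asymptotics.IsEquivalent atTop
      (fun m => (WithLp.toLp 2 (M⁻¹ *ᵥ z m) : EuclideanSpace ℝ (Fin n))) h := by
    have := h2.neg_left
    refine this.congr_left fun m => ?_
    simp
  exact h4.symm

/-- This is the sandwich `M⁻¹ M M⁻¹ = M⁻¹`: the limit is the form of `M` at `b = M⁻¹ t`. -/
theorem tendsto_runningMean_sq_inner_inv_mulVec {u : Fin n → ℕ → ℝ}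
    {M : Matrix (Fin n) (Fin n) ℝ} (hM : M.PosDef) (hu : ∀ j k, HasTailProduct (u j) (u k) (M j k))
    (t : EuclideanSpace ℝ (Fin n)) :
    Tendsto (runningMean fun i =>
      ⟪(WithLp.toLp 2 (M⁻¹ *ᵥ fun j => u j i) : EuclideanSpace ℝ (Fin n)), t⟫_ℝ ^ 2) atTop
      (𝓝 (t ⬝ᵥ M⁻¹ *ᵥ t)) := by
  set b : Fin n → ℝ := M⁻¹ *ᵥ t with hb
  have hsymm : M⁻¹ᵀ = M⁻¹ := by
    have := hM.inv.isHermitian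
    rwa [Matrix.IsHermitian, Matrix.conjTranspose_eq_transpose_of_trivial] at this
  have h1 : ∀ i, ⟪(WithLp.toLp 2 (M⁻¹ *ᵥ fun j => u j i) : EuclideanSpace ℝ (Fin n)), t⟫_ℝ
      = ∑ j, u j i * b j := fun i => by
    have e1 : ⟪(WithLp.toLp 2 (M⁻¹ *ᵥ fun j => u j i) : EuclideanSpace ℝ (Fin n)), t⟫_ℝ
        = (t : Fin n → ℝ) ⬝ᵥ (M⁻¹ *ᵥ fun j => u j i) := by
      simp [PiLp.inner_apply, dotProduct]
    rw [e1, Matrix.dotProduct_mulVec, ← Matrix.mulVec_transpose, hsymm, dotProduct_comm]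
    rfl
  have h2 : (runningMean fun i =>
      ⟪(WithLp.toLp 2 (M⁻¹ *ᵥ fun j => u j i) : EuclideanSpace ℝ (Fin n)), t⟫_ℝ ^ 2)
      = fun m => ∑ j, ∑ k, b j * b k * runningMean (fun i => u j i * u k i) m := by
    funext m
    simp_rw [← runningMean_const_mul, ← runningMean_finset_sum]
    congr 1
    funext i
    rw [h1, sq, Finset.sum_mul_sum]
    refine Finset.sum_congr rfl fun j _ => Finset.sum_congr rfl fun k _ => ?_
    ring
  have h3 : (t : Fin n → ℝ) ⬝ᵥ M⁻¹ *ᵥ t = ∑ j, ∑ k, b j * b k * M j k := by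
    have e2 : M *ᵥ b = t := by
      rw [hb, Matrix.mulVec_mulVec,
        Matrix.mul_nonsing_inv _ ((Matrix.isUnit_iff_isUnit_det M).1 hM.isUnit), Matrix.one_mulVec]
    rw [← hb]
    nth_rw 1 [← e2]
    rw [dotProduct_comm]
    simp only [dotProduct, Matrix.mulVec, Finset.mul_sum]
    refine Finset.sum_congr rfl fun j _ => Finset.sum_congr rfl fun k _ => ?_
    ring
  rw [h2, h3]
  exact tendsto_finsetSum _ fun j _ => tendsto_finsetSum _ fun k _ => (hu j k).const_mul _

end

/-! ### Assembly of the main theorem. -/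

theorem theorem1 {n : ℕ} {Ω : Type*} [MeasurableSpace Ω] (P : Measure Ω) [IsProbabilityMeasure P]
    -- i.i.d. Gaussian noises with mean zero and variance `σ²`
    (σ : ℝ≥0) (r : ℕ → Ω → ℝ) (hr_indep : iIndepFun r P)
    (hr_law : ∀ i, HasLaw (r i) (gaussianReal 0 (σ ^ 2)) P)
    -- object position, parameter set and sensor positions
    (xo : EuclideanSpace ℝ (Fin n)) (𝒳 : Set (EuclideanSpace ℝ (Fin n)))
    (h𝒳 : IsCompact 𝒳) (hxo : xo ∈ interior 𝒳)
    (𝒜 : Set (EuclideanSpace ℝ (Fin n))) (h𝒜 : Bornology.IsBounded 𝒜)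
    (a : ℕ → EuclideanSpace ℝ (Fin n)) (ha : ∀ i, a i ∈ 𝒜) (ha𝒳 : ∀ i, a i ∉ 𝒳)
    -- convergence of the sample distribution functions
    (μ : Measure (EuclideanSpace ℝ (Fin n))) [IsProbabilityMeasure μ]
    (hμ : SampleCDFTendsto a μ)
    -- search region of the least squares problem: the whole space or the compact set
    (Θ : Set (EuclideanSpace ℝ (Fin n))) (hΘ : Θ = Set.univ ∨ Θ = 𝒳)
    -- localizability and non-degeneracy, or the unified condition on the sensors
    (hdeploy :
      (AsymptoticallyUniquelyLocalizable Θ a xo ∧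
        ¬ ∃ S : AffineSubspace ℝ (EuclideanSpace ℝ (Fin n)),
          IsAffineHyperplane S ∧ xo ∈ S ∧ μ (S : Set (EuclideanSpace ℝ (Fin n))) = 1) ∨
      ¬ ∃ S : AffineSubspace ℝ (EuclideanSpace ℝ (Fin n)),
          IsAffineHyperplane S ∧ μ (S : Set (EuclideanSpace ℝ (Fin n))) = 1)
    -- the least squares estimator from the measurements `d i = ‖a i - xo‖ + r i`
    (xLS : ℕ → Ω → EuclideanSpace ℝ (Fin n)) (hxLS_meas : ∀ m, AEMeasurable (xLS m) P)
    (hxLS : ∀ m, ∀ᵐ ω ∂P, IsLSEstimate Θ a (fun i => ‖a i - xo‖ + r i ω) m (xLS m ω)) :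
    (∀ᵐ ω ∂P, Tendsto (fun m => xLS m ω) atTop (𝓝 xo)) ∧
    (∀ j k, HasTailProduct (rangePartial a j xo) (rangePartial a k xo) (tailGram a xo j k)) ∧
    (tailGram a xo).PosDef ∧
    TendstoInDistribution (fun (m : ℕ) ω => √(m : ℝ) • (xLS m ω - xo)) atTop id (fun _ => P)
      (multivariateGaussian 0 ((σ : ℝ) ^ 2 • (tailGram a xo)⁻¹)) := by
  have hΘn : Θ ∈ 𝓝 xo := by
    rcases hΘ with rfl | rfl
    · exact univ_mem
    · exact mem_interior_iff_mem_nhds.1 hxo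
  have hΘc : IsClosed Θ := by
    rcases hΘ with rfl | rfl
    · exact isClosed_univ
    · exact h𝒳.isClosed
  -- A ball around `xo` inside `𝒳` contains no sensor; its radius bounds all distances to `xo` from
  -- below.
  obtain ⟨c, hc, hball⟩ := Metric.mem_nhds_iff.1 (mem_interior_iff_mem_nhds.1 hxo)
  have hv : ∀ i, c ≤ ‖xo - a i‖ := fun i => by
    by_contra! hlt
    refine ha𝒳 i (hball ?_)
    rwa [Metric.mem_ball, dist_eq_norm, norm_sub_rev]
  obtain ⟨A, hA⟩ := h𝒜.subset_closedBall xo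
  have hA' : ∀ i, ‖a i - xo‖ ≤ A := fun i => by
    have := hA (ha i)
    rwa [Metric.mem_closedBall, dist_eq_norm] at this
  have hQpos : ∀ x ∈ Θ, x ≠ xo → 0 < meanSqDiscrepancy μ xo x := by
    rcases hdeploy with ⟨h, -⟩ | h
    · exact fun x hx hne => h.meanSqDiscrepancy_pos hμ hx hne
    · exact fun x _ hne => meanSqDiscrepancy_pos_of_not_hyperplane h hne
  have hplane : ¬ ∃ S : AffineSubspace ℝ (EuclideanSpace ℝ (Fin n)),
      IsAffineHyperplane S ∧ xo ∈ S ∧ μ (S : Set (EuclideanSpace ℝ (Fin n))) = 1 := by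
    rcases hdeploy with ⟨-, h⟩ | h
    · exact h
    · exact fun ⟨S, hS, _, hS1⟩ => h ⟨S, hS, hS1⟩
  have hM := hμ.hasTailProduct_rangePartial hc hv
  have hgram : tailGram a xo = gramLimit μ xo c := by
    ext j k
    exact (hM j k).tailProduct_eq
  rw [hgram]
  have hpd := posDef_gramLimit hc hplane
  set M := gramLimit μ xo c
  have hpart : ∀ j i, |rangePartial a j xo i| ≤ 1 := fun j i => by
    have hne : a i ≠ xo := fun h => by
      have := hv i
      rw [h, sub_self, norm_zero] at this
      linarith
    rw [rangePartial_eq hne]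
    simpa using abs_inner_div_norm_le_norm (xo - a i) (EuclideanSpace.single j (1 : ℝ))
  have hinv : ∀ i, |‖xo - a i‖⁻¹| ≤ c⁻¹ := fun i => by
    rw [abs_of_nonneg (by positivity)]
    exact inv_anti₀ hc (hv i)
  -- Countability lets one null set serve all points of `D`; density then reaches every `x`.
  obtain ⟨D, hDc, hD⟩ := TopologicalSpace.exists_countable_dense (EuclideanSpace ℝ (Fin n))
  have hN₀ : ∀ᵐ ω ∂P, ∀ x ∈ D, Tendsto
      (runningMean fun i => (rangeSeq a x i - rangeSeq a xo i) * r i ω) atTop (𝓝 0) :=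
    (ae_ball_iff hDc).2 fun x _ =>
      ae_tendsto_weighted_average hr_indep hr_law (abs_rangeSeq_sub_le x xo)
  have hN₁ : ∀ᵐ ω ∂P, Tendsto (runningMean fun i => ‖xo - a i‖⁻¹ * r i ω) atTop (𝓝 0) :=
    ae_tendsto_weighted_average hr_indep hr_law hinv
  have hN₂ : ∀ᵐ ω ∂P, ∀ j k, Tendsto (runningMean fun i =>
      rangePartial a j xo i * rangePartial a k xo i * ‖xo - a i‖⁻¹ * r i ω) atTop (𝓝 0) := by
    refine ae_all_iff.2 fun j => ae_all_iff.2 fun k => ?_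
    refine ae_tendsto_weighted_average hr_indep hr_law (C := 1 * 1 * c⁻¹) fun i => ?_
    rw [abs_mul, abs_mul]
    gcongr
    exacts [hpart j i, hpart k i, hinv i]
  have hLS := ae_all_iff.2 hxLS
  have hB : ∀ᵐ ω ∂P, ∃ B, ∀ m, runningMean (fun i => r i ω ^ 2) m ≤ B := by
    filter_upwards [ae_exists_tendsto_average_sq hr_indep hr_law] with ω ⟨L, hL⟩
    obtain ⟨B, hB⟩ := hL.bddAbove_range
    exact ⟨B, fun m => hB ⟨m, rfl⟩⟩
  have hcons : ∀ᵐ ω ∂P, Tendsto (fun m => xLS m ω) atTop (𝓝 xo) := by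
    filter_upwards [hN₀, hLS, hB] with ω hN₀ hLS ⟨B, hB⟩
    refine tendsto_of_isLSEstimate hA' hB (tendsto_runningMean_noise_of_dense hB hD hN₀) hΘc
      (mem_of_mem_nhds hΘn) (Q := meanSqDiscrepancy μ xo) (fun x => ?_) hQpos hLS
    refine (hμ.hasTailProduct_rangeSeq_sub xo x).congr fun m => ?_
    simp [runningMean, sq]
  refine ⟨hcons, hM, hpd, ?_⟩
  set W : ℕ → EuclideanSpace ℝ (Fin n) := fun i =>
    WithLp.toLp 2 (M⁻¹ *ᵥ fun j => rangePartial a j xo i)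
  have hclt := tendstoInDistribution_weighted_sum hr_indep hr_law hpd.inv.posSemidef
    (W := W) (tendsto_runningMean_sq_inner_inv_mulVec hpd hM)
  have hsq : ((σ ^ 2 : ℝ≥0) : ℝ) = (σ : ℝ) ^ 2 := by push_cast; rfl
  rw [hsq] at hclt
  refine hclt.of_ae_isLittleO (fun m => by fun_prop) ?_
  filter_upwards [hN₁, hN₂, hLS, hB, hcons] with ω hN₁ hN₂ hLS ⟨B, hB⟩ hlim
  have ho := isLittleO_sub_of_normal_equation hpd.isUnit
    (isLittleO_normal_equation hc hv hB hM hN₁ hN₂ hΘn hLS hlim)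
  have hY : ∀ m : ℕ, (√(m : ℝ))⁻¹ • ∑ i ∈ Finset.range m, r i ω • W i
      = √(m : ℝ) • WithLp.toLp 2
        (M⁻¹ *ᵥ fun j => runningMean (fun i => rangePartial a j xo i * r i ω) m) := fun m => by
    have h1 : (fun j => runningMean (fun i => rangePartial a j xo i * r i ω) m)
        = (m : ℝ)⁻¹ • ∑ i ∈ Finset.range m, r i ω • fun j => rangePartial a j xo i := by
      funext j
      simp only [runningMean, Pi.smul_apply, Finset.sum_apply, smul_eq_mul, mul_comm]
    have h2 : √(m : ℝ) * (m : ℝ)⁻¹ = (√(m : ℝ))⁻¹ := by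
      rcases Nat.eq_zero_or_pos m with rfl | hm
      · simp
      · have hm' : (0 : ℝ) < √(m : ℝ) := by positivity
        nth_rw 2 [← Real.sq_sqrt (Nat.cast_nonneg m : (0 : ℝ) ≤ m)]
        field_simp
    rw [h1, Matrix.mulVec_smul, Matrix.mulVec_sum, WithLp.toLp_smul, smul_smul, h2,
      WithLp.toLp_sum]
    simp only [Matrix.mulVec_smul, WithLp.toLp_smul, W]
  simp_rw [hY, ← smul_sub]
  -- The little-o relation is relative, hence survives multiplication of both sides by `√m`.
  exact (Asymptotics.isBigO_refl (fun m : ℕ => √(m : ℝ)) atTop).smul_isLittleO ho
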